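/- **Setting.** Let $\mathbb U$ be the closed complex unit disc, $\mathbb S^1$ the unit circle, $\mathbb T=\mathbb R/\mathbb Z$, $\mathbb N=\{1,2,\dots\}$, and $e(\alpha)=e^{2\pi i\alpha}$. Write $a_m\prec b_m$ if $a_m/b_m\to 0$ as $m\to\infty$. Let $f\colon\mathbb N\to\mathbb S^1$ be an *MRT function*, i.e. $f$ is completely multiplicative and there are strictly increasing sequences of integers $(t_m)_{m\ge1}$, with $t_1=1$, and $(s_m)_{m\ge1}$, which we fix, such that for every $m\in\mathbb N$: (i) $t_m<s_{m+1}<s_{m+1}^2\le t_{m+1}$; (ii) $f(p)=p^{is_{m+1}}$ for every prime $p\in(t_m,t_{m+1}]$; (iii) $|f(p)-p^{is_{m+1}}|\le 1/t_m^2$ for every prime $p\le t_m$. Let $X=\mathbb U^{\mathbb Z}$ with the product topology, let $T\colon X\to X$, $(Tx)(k)=x(k+1)$, be the shift, and let $F_0(x)=x(0)$. Extend $f$ in an arbitrary way to a sequence $f\in X$ (the values $f(n)$, $n\le0$, in $\mathbb U$ are arbitrary). The *Furstenberg system of $f$ for Cesàro averages along $([N_m])$* is $(X,\mu,T)$, where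 $\mu$ is the Borel probability measure $\mu=\lim_{m\to\infty}\frac1{N_m}\sum_{n=1}^{N_m}\delta_{T^nf}$, provided that this weak-star limit exists. For $d\in\{0,1,2,\dots\}$ the *level $d$ unipotent system* is $(\mathbb T^{d+1},m_{\mathbb T^{d+1}},S_d)$, where $m_{\mathbb T^{d+1}}$ is Haar probability measure and $$S_d(x_0,\dots,x_d)=(x_0,\,x_1+x_0,\,\dots,\,x_d+x_{d-1}).$$ **Theorem.** Let $d\in\{0,1,2,\dots\}$ and let $(N_m)_{m\ge1}$ be a sequence of positive integers such that $$s_{m+1}^{1/(d+1)}\prec N_m\prec s_{m+1}^{1/d}\quad\text{if } d\ge1,\qquad s_{m+1}\prec N_m \text{ and } N_m\le t_{m+1} \text{ for all } m\quad\text{if } d=0.$$ Then the Furstenberg system $(X,\mu_d,T)$ of $f$ for Cesàro averages along $([N_m])$ exists (i.e. the weak-star limit exists, and it is $T$-invariant), and: 1. it has trivial spectrum: the only $\alpha\in[0,1)$ for which there is a non-zero $g\in L^2(\mu_d)$ with $g\circ T=e(\alpha)\,g$ is $\alpha=0$; 2. it is strongly stationary: for all $\ell,r\in\mathbb N$, $n_1,\dots,n_\ell\in\mathbb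 Z$ and $F_1,\dots,F_\ell\in\{F_0,\overline{F_0}\}$, $$\int\prod_{j=1}^\ell F_j\circ T^{n_j}\,d\mu_d=\int\prod_{j=1}^\ell F_j\circ T^{rn_j}\,d\mu_d;$$ 3. it is isomorphic to the level $d$ unipotent system: there is a measurable $\Phi\colon X\to\mathbb T^{d+1}$ with $\Phi_*\mu_d=m_{\mathbb T^{d+1}}$ and $S_d\circ\Phi=\Phi\circ T$ $\mu_d$-almost everywhere, which is injective on a measurable $T$-invariant set of full $\mu_d$-measure. -/

import Mathlib

open MeasureTheory Filter Topology

noncomputable section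

/-! ### MRT multiplicative functions -/

/-- `a n ≺ b n`, i.e. `a n / b n → 0`. -/
def Prec (a b : ℕ → ℝ) : Prop :=
  Tendsto (fun n => a n / b n) atTop (𝓝 0)

/-- A completely multiplicative function `f : {1, 2, …} → 𝕊¹` (that is, a monoid homomorphism
from the positive integers to the unit circle) is an MRT function with respect to the sequences of
integers `(t_m)` and `(s_m)`, `m = 1, 2, …`. The values of `t` and `s` at `0` play no role.
An MRT function is one for which such sequences exist. -/
structure IsMRTWith (f : ℕ+ →* Circle) (t s : ℕ → ℤ) : Prop where
  t_strictMono : StrictMonoOn t (Set.Ici 1)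
  s_strictMono : StrictMonoOn s (Set.Ici 1)
  t_one : t 1 = 1
  growth : ∀ m : ℕ, 1 ≤ m →
    t m < s (m + 1) ∧ s (m + 1) < s (m + 1) ^ 2 ∧ s (m + 1) ^ 2 ≤ t (m + 1)
  eq_on_large : ∀ m : ℕ, 1 ≤ m → ∀ p : ℕ+, p.Prime →
    t m < ((p : ℕ) : ℤ) → ((p : ℕ) : ℤ) ≤ t (m + 1) →
      (f p : ℂ) = ((p : ℕ) : ℂ) ^ (Complex.I * ((s (m + 1) : ℤ) : ℂ))
  approx_on_small : ∀ m : ℕ, 1 ≤ m → ∀ p : ℕ+, p.Prime → ((p : ℕ) : ℤ) ≤ t m →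
      ‖(f p : ℂ) - ((p : ℕ) : ℂ) ^ (Complex.I * ((s (m + 1) : ℤ) : ℂ))‖ ≤ 1 / (t m : ℝ) ^ 2

/-! ### Measure preserving systems: spectrum and isomorphism -/

/-- The spectrum of a system `(X, μ, T)`: the set of `α ∈ [0, 1)` for which there is a non-zero
`g ∈ L²(μ)` with `g ∘ T = e(α) g`, where `e(α) = exp (2 π i α)`. -/
def systemSpectrum {X : Type*} [MeasurableSpace X] (μ : Measure X) (T : X → X) : Set ℝ :=
  {α | α ∈ Set.Ico (0 : ℝ) 1 ∧ ∃ g : X → ℂ, MemLp g 2 μ ∧ ¬ (g =ᵐ[μ] 0) ∧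
    ∀ᵐ x ∂μ, g (T x) = Complex.exp (2 * Real.pi * Complex.I * α) * g x}

/-- The systems `(X, μ, T)` and `(Y, ν, S)` are isomorphic: there is a factor map `Φ : X → Y` which
is injective on a `T`-invariant (measurable) set of full measure. -/
def SystemIsomorphic {X Y : Type*} [MeasurableSpace X] [MeasurableSpace Y]
    (μ : Measure X) (T : X → X) (ν : Measure Y) (S : Y → Y) : Prop :=
  ∃ Φ : X → Y, MeasurePreserving Φ μ ν ∧ (∀ᵐ x ∂μ, S (Φ x) = Φ (T x)) ∧
    ∃ A : Set X, MeasurableSet A ∧ T ⁻¹' A = A ∧ μ Aᶜ = 0 ∧ Set.InjOn Φ A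

/-- The transformation of the level `d` unipotent system on `𝕋^{d+1}`,
`(x₀, …, x_d) ↦ (x₀, x₁ + x₀, …, x_d + x_{d-1})`. -/
def unipotentMap (d : ℕ) (x : Fin (d + 1) → UnitAddCircle) : Fin (d + 1) → UnitAddCircle :=
  Fin.cases (x 0) (fun i : Fin d => x i.succ + x i.castSucc)

/-! ### Sequence space systems and Furstenberg systems -/

/-- The closed complex unit disc. -/
abbrev ClosedUnitDisc : Type := Metric.closedBall (0 : ℂ) 1

/-- The space of two-sided sequences with values in the closed unit disc, with the product topology
and its Borel `σ`-algebra. -/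
abbrev SeqSpace : Type := ℤ → ClosedUnitDisc

/-- The shift `(T x)(k) = x (k + 1)`, as an invertible transformation. -/
def shift : Equiv.Perm SeqSpace where
  toFun x := fun k => x (k + 1)
  invFun x := fun k => x (k - 1)
  left_inv x := by funext k; simp
  right_inv x := by funext k; simp

/-- The `0`-th coordinate projection. -/
def coordZero (x : SeqSpace) : ℂ := (x 0 : ℂ)

/-- The probability measure `μ` on the sequence space defines the Furstenberg system of the sequence
`a` along `([N_m])` for Cesàro averages: `μ` is the weak-star limit of the measures
`(1 / N_m) ∑_{n = 1}^{N_m} δ_{T^n a}`. -/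
structure IsFurstenbergMeasure (a : SeqSpace) (N : ℕ → ℕ) (μ : Measure SeqSpace) : Prop where
  isProbabilityMeasure : IsProbabilityMeasure μ
  tendsto : ∀ F : C(SeqSpace, ℂ),
    Tendsto (fun m => (1 / (N m : ℂ)) * ∑ n ∈ Finset.Icc 1 (N m), F ((shift ^ n) a)) atTop
      (𝓝 (∫ x, F x ∂μ))

/-- A sequence space system `(X, μ, T)` is strongly stationary if
`∫ ∏ⱼ T^{nⱼ} Fⱼ dμ = ∫ ∏ⱼ T^{r nⱼ} Fⱼ dμ` for all `ℓ, r ≥ 1`, all integers `n₁, …, n_ℓ` and all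
`F₁, …, F_ℓ` among the `0`-th coordinate projection and its complex conjugate. -/
def StronglyStationary (μ : Measure SeqSpace) : Prop :=
  ∀ (l r : ℕ), 1 ≤ l → 1 ≤ r → ∀ (n : Fin l → ℤ) (F : Fin l → SeqSpace → ℂ),
    (∀ j, F j = coordZero ∨ F j = fun x => (starRingEnd ℂ) (coordZero x)) →
      ∫ x, ∏ j, F j ((shift ^ n j) x) ∂μ = ∫ x, ∏ j, F j ((shift ^ ((r : ℤ) * n j)) x) ∂μ

end

/-!
For `n ≤ t (m + 1)` the value `f n` differs from `n ^ {i s}`, `s = s (m + 1)`, by at most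
`1 / (t m) ^ 2` for each prime factor of `n` up to `t m`; as `∑_{n ≤ N} v_p(n) = v_p(N!) ≤ N`, the
error is at most `1 / t m` on average over `[1, N]`, and it disappears from the correlations of `f`
(`IsMRTWith.tendsto_cesaro_correlation`).

It remains to average `e^{i S θ(n)}`, where `θ(x) = ∑ⱼ εⱼ log (x + hⱼ)` and `εⱼ = ±1`, in the range
`N ^ d ≺ S ≺ N ^ (d + 1)`. Let `k` be the order of the first non-vanishing moment `∑ⱼ εⱼ hⱼ ^ k`,
so that `θ(x)` is of order `x ^ {-k}` (or `log x` if `k = 0`).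
* If `k > d`, then `S θ(n) → 0` on most of `[1, N]` and the averages tend to `1`
  (`tendsto_cesaro_logPhase_one`).
* If `k = d`, then `S θ'(x) ~ S κ x ^ {-(d + 1)}` is small, and `x ^ (d + 1) e^{i S θ(x)} / (i S κ)`
  is nearly a primitive of `e^{i S θ(x)}`; telescoping bounds the averages by `N ^ d / S → 0`
  (`tendsto_cesaro_exp_of_deriv`).
* If `k < d`, van der Corput's difference lemma (`tendsto_cesaro_of_correlations`) replaces the
  weights `ε` by the difference of two of their translates, which raises `k` by one; repeating
  this leads to the previous case (`tendsto_cesaro_logPhase_zero`).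

On the other side, code a point `x` of the torus by the sequence `k ↦ e((S_d ^ k x)_d)`, whose
entries are characters of `x` with binomial coefficients in `k` as frequencies. A correlation of
this sequence under Haar measure is `1` or `0` according to whether its character is trivial, that
is, whether all binomial moments up to order `d` vanish, which is the same condition as for
power moments (`forall_weightedMoment_eq_zero_iff`, `integral_correlation_orbitMeasure`). Since the
monomials in the coordinates span a dense subspace of the continuous functions, the law
`orbitMeasure d` of the coded orbit is the Furstenberg measure of `f`.

The coding is injective, continuous and equivariant, so its inverse is the required isomorphism.
Strong stationarity holds because dilating the `hⱼ` multiplies moments by non-zero factors. The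
spectrum is computed on the torus with Fourier coefficients: an eigenfunction has
coefficients of constant modulus along the orbits of the dual unipotent map, which are infinite or
fixed points (`ae_eq_zero_of_comp_unipotentMap`).
-/

noncomputable section

/-! ### Cesàro means and van der Corput's difference lemma -/

/-- The Cesàro mean of `u 1, …, u N`. -/
def cesaro (N : ℕ) (u : ℕ → ℂ) : ℂ := (1 / (N : ℂ)) * ∑ n ∈ Finset.Icc 1 N, u n

lemma norm_cesaro (N : ℕ) (u : ℕ → ℂ) :
    ‖cesaro N u‖ = ‖∑ n ∈ Finset.Icc 1 N, u n‖ / N := by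
  simp [cesaro, div_eq_inv_mul]

lemma norm_cesaro_le (N : ℕ) (u : ℕ → ℂ) :
    ‖cesaro N u‖ ≤ (∑ n ∈ Finset.Icc 1 N, ‖u n‖) / N := by
  rw [norm_cesaro]; gcongr; exact norm_sum_le _ _

lemma cesaro_sub (N : ℕ) (u v : ℕ → ℂ) :
    cesaro N (fun n => u n - v n) = cesaro N u - cesaro N v := by
  simp [cesaro, mul_sub]

lemma cesaro_const {N : ℕ} (hN : N ≠ 0) (c : ℂ) : cesaro N (fun _ => c) = c := by
  have : (N : ℂ) ≠ 0 := by exact_mod_cast hN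
  simp [cesaro]; field_simp

lemma cesaro_sum {ι : Type*} (s : Finset ι) (N : ℕ) (u : ι → ℕ → ℂ) :
    cesaro N (fun n => ∑ i ∈ s, u i n) = ∑ i ∈ s, cesaro N (u i) := by
  simp only [cesaro, Finset.mul_sum]; rw [Finset.sum_comm]

lemma norm_cesaro_shift_sub_le {u : ℕ → ℂ} (hu : ∀ n, ‖u n‖ ≤ 1) (N i : ℕ) :
    ‖cesaro N (fun n => u (n + i)) - cesaro N u‖ ≤ 2 * i / N := by
  have key : ∀ i : ℕ, ‖∑ n ∈ Finset.Icc 1 N, u (n + i) - ∑ n ∈ Finset.Icc 1 N, u n‖ ≤ 2 * i := by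
    intro i
    induction i with
    | zero => simp
    | succ i ih =>
      have h1 : ∑ n ∈ Finset.Icc 1 N, u (n + (i + 1)) - ∑ n ∈ Finset.Icc 1 N, u (n + i)
          = u (N + 1 + i) - u (1 + i) := by
        rw [← Finset.sum_sub_distrib, ← Finset.Ico_succ_right_eq_Icc]
        have := Finset.sum_Ico_sub (fun n => u (n + i)) (show 1 ≤ N + 1 by omega)
        rw [← this]
        refine Finset.sum_congr rfl fun n _ => ?_
        rw [show n + (i + 1) = n + 1 + i by ring]
      calc _ = ‖(u (N + 1 + i) - u (1 + i)) +
            (∑ n ∈ Finset.Icc 1 N, u (n + i) - ∑ n ∈ Finset.Icc 1 N, u n)‖ := by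
              rw [← h1]; congr 1; ring
        _ ≤ (1 + 1) + 2 * i := by
              refine (norm_add_le _ _).trans (add_le_add ((norm_sub_le _ _).trans ?_) ih)
              exact add_le_add (hu _) (hu _)
        _ = _ := by push_cast; ring
  calc _ = ‖∑ n ∈ Finset.Icc 1 N, u (n + i) - ∑ n ∈ Finset.Icc 1 N, u n‖ / N := by
        rw [cesaro, cesaro, ← mul_sub, norm_mul]; simp [div_eq_inv_mul]
    _ ≤ _ := by gcongr; exact key i

/-- Jensen's inequality for the square of a Cesàro mean of a sum, with the square expanded. -/
lemma sq_norm_cesaro_sum_le (N H : ℕ) (u : ℕ → ℂ) :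
    ‖cesaro N (fun n => ∑ i ∈ Finset.range H, u (n + i))‖ ^ 2 ≤
      ∑ i ∈ Finset.range H, ∑ j ∈ Finset.range H,
        ‖cesaro N (fun n => u (n + i) * (starRingEnd ℂ) (u (n + j)))‖ := by
  rcases Nat.eq_zero_or_pos N with rfl | hN
  · simp [cesaro]
  have hN' : (0 : ℝ) < N := by exact_mod_cast hN
  set w : ℕ → ℂ := fun n => ∑ i ∈ Finset.range H, u (n + i) with hw
  have hsq : ∀ n, ((‖w n‖ ^ 2 : ℝ) : ℂ) = ∑ i ∈ Finset.range H, ∑ j ∈ Finset.range H,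
      u (n + i) * (starRingEnd ℂ) (u (n + j)) := by
    intro n
    rw [← Finset.sum_mul_sum, ← map_sum, Complex.mul_conj, Complex.normSq_eq_norm_sq]
  have h1 : ‖cesaro N w‖ ^ 2 ≤ (∑ n ∈ Finset.Icc 1 N, ‖w n‖ ^ 2) / N := by
    have := sq_sum_le_card_mul_sum_sq (s := Finset.Icc 1 N) (f := fun n => ‖w n‖)
    rw [Nat.card_Icc, Nat.add_sub_cancel] at this
    calc _ ≤ ((∑ n ∈ Finset.Icc 1 N, ‖w n‖) / N) ^ 2 := by
          gcongr; exact norm_cesaro_le _ _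
      _ = (∑ n ∈ Finset.Icc 1 N, ‖w n‖) ^ 2 / N ^ 2 := by rw [div_pow]
      _ ≤ (N * ∑ n ∈ Finset.Icc 1 N, ‖w n‖ ^ 2) / N ^ 2 := by gcongr
      _ = _ := by field_simp
  have h2 : (((∑ n ∈ Finset.Icc 1 N, ‖w n‖ ^ 2) / N : ℝ) : ℂ) =
      ∑ i ∈ Finset.range H, ∑ j ∈ Finset.range H,
        cesaro N (fun n => u (n + i) * (starRingEnd ℂ) (u (n + j))) := by
    simp_rw [← cesaro_sum, ← hsq]
    simp [cesaro, div_eq_inv_mul]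
  have h3 : (∑ n ∈ Finset.Icc 1 N, ‖w n‖ ^ 2) / N =
      ‖(((∑ n ∈ Finset.Icc 1 N, ‖w n‖ ^ 2) / N : ℝ) : ℂ)‖ := by
    rw [Complex.norm_real, Real.norm_of_nonneg (by positivity)]
  rw [h3, h2] at h1
  refine h1.trans ((norm_sum_le _ _).trans (Finset.sum_le_sum fun i _ => norm_sum_le _ _))

/-- Van der Corput's difference lemma for a varying family of bounded sequences: if all
off-diagonal correlations have vanishing means, then so do the sequences themselves. -/
theorem tendsto_cesaro_of_correlations {N : ℕ → ℕ} (hN : Tendsto N atTop atTop)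
    {g : ℕ → ℕ → ℂ} (hg : ∀ m n, ‖g m n‖ ≤ 1)
    (hcor : ∀ i j : ℕ, i ≠ j → Tendsto
      (fun m => cesaro (N m) (fun n => g m (n + i) * (starRingEnd ℂ) (g m (n + j)))) atTop (𝓝 0)) :
    Tendsto (fun m => cesaro (N m) (g m)) atTop (𝓝 0) := by
  have hNr : Tendsto (fun m => (N m : ℝ)) atTop atTop := tendsto_natCast_atTop_atTop.comp hN
  rw [tendsto_zero_iff_norm_tendsto_zero, Metric.tendsto_atTop']
  -- average over `H` shifts; the `H` diagonal correlations contribute at most `H` to the square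
  have main : ∀ H : ℕ, 0 < H → ∀ᶠ m in atTop,
      ‖cesaro (N m) (g m)‖ ≤ 2 * H / N m + √(2 * H) / H := by
    intro H hH
    have hHr : (1 : ℝ) ≤ H := by exact_mod_cast hH
    have hoff : Tendsto (fun m => ∑ i ∈ Finset.range H, ∑ j ∈ (Finset.range H).erase i,
        ‖cesaro (N m) (fun n => g m (n + i) * (starRingEnd ℂ) (g m (n + j)))‖) atTop (𝓝 0) := by
      rw [show (0 : ℝ) = ∑ i ∈ Finset.range H, ∑ j ∈ (Finset.range H).erase i, 0 by simp]
      refine tendsto_finsetSum _ fun i _ => tendsto_finsetSum _ fun j hj => ?_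
      simpa using (hcor i j (Finset.ne_of_mem_erase hj).symm).norm
    filter_upwards [hoff.eventually_lt_const zero_lt_one, hN.eventually_gt_atTop 0] with m hm hNm
    have hNm' : (0 : ℝ) < N m := by exact_mod_cast hNm
    set w := cesaro (N m) (fun n => ∑ i ∈ Finset.range H, g m (n + i)) with hw
    have hw2 : ‖w‖ ^ 2 ≤ 2 * H := by
      refine (sq_norm_cesaro_sum_le (N m) H (g m)).trans ?_
      have hsplit : ∀ i ∈ Finset.range H, ∑ j ∈ Finset.range H,
          ‖cesaro (N m) (fun n => g m (n + i) * (starRingEnd ℂ) (g m (n + j)))‖ ≤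
          1 + ∑ j ∈ (Finset.range H).erase i,
            ‖cesaro (N m) (fun n => g m (n + i) * (starRingEnd ℂ) (g m (n + j)))‖ := by
        intro i hi
        rw [← Finset.add_sum_erase _ _ hi]
        gcongr
        refine (norm_cesaro_le _ _).trans ?_
        rw [div_le_one hNm']
        calc _ ≤ ∑ n ∈ Finset.Icc 1 (N m), (1 : ℝ) := by
              gcongr with n
              rw [norm_mul, RCLike.norm_conj]
              exact mul_le_one₀ (hg _ _) (norm_nonneg _) (hg _ _)
          _ = N m := by simp
      refine (Finset.sum_le_sum hsplit).trans ?_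
      rw [Finset.sum_add_distrib]
      simp only [Finset.sum_const, Finset.card_range, nsmul_eq_mul, mul_one]
      linarith
    have hw' : ‖w‖ ≤ √(2 * H) := Real.le_sqrt_of_sq_le hw2
    have hdiff : ‖w - H * cesaro (N m) (g m)‖ ≤ H * (2 * H / N m) := by
      rw [hw, cesaro_sum]
      have : (H : ℂ) * cesaro (N m) (g m) = ∑ i ∈ Finset.range H, cesaro (N m) (g m) := by simp
      rw [this, ← Finset.sum_sub_distrib]
      refine (norm_sum_le _ _).trans ?_
      calc _ ≤ ∑ i ∈ Finset.range H, (2 * H / N m : ℝ) := by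
            refine Finset.sum_le_sum fun i hi => (norm_cesaro_shift_sub_le (hg m) _ _).trans ?_
            have : (i : ℝ) ≤ H := by exact_mod_cast (Finset.mem_range.1 hi).le
            gcongr
        _ = _ := by simp
    have h3 : (H : ℝ) * ‖cesaro (N m) (g m)‖ ≤ √(2 * H) + H * (2 * H / N m) := by
      calc _ = ‖(H : ℂ) * cesaro (N m) (g m)‖ := by simp
        _ = ‖w - (w - H * cesaro (N m) (g m))‖ := by congr 1; ring
        _ ≤ _ := (norm_sub_le _ _).trans (add_le_add hw' hdiff)
    have hH0 : (0 : ℝ) < H := by linarith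
    calc ‖cesaro (N m) (g m)‖ = (H * ‖cesaro (N m) (g m)‖) / H := by field_simp
      _ ≤ (√(2 * H) + H * (2 * H / N m)) / H := by gcongr
      _ = _ := by field_simp; ring
  intro ε hε
  obtain ⟨H, hH⟩ := exists_nat_gt (8 / ε ^ 2)
  have hHr : (0 : ℝ) < H := lt_trans (by positivity) hH
  have hHpos : 0 < H := by exact_mod_cast hHr
  have hsq : √(2 * H) / H < ε / 2 := by
    rw [div_lt_iff₀ hHr, Real.sqrt_lt' (by positivity)]
    rw [div_lt_iff₀ (by positivity)] at hH
    nlinarith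
  have hlim : Tendsto (fun m => 2 * (H : ℝ) / N m) atTop (𝓝 0) := hNr.const_div_atTop _
  have := (main H hHpos).and (hlim.eventually_lt_const (half_pos hε))
  obtain ⟨M, hM⟩ := eventually_atTop.1 this
  refine ⟨M, fun m hm => ?_⟩
  obtain ⟨h1, h2⟩ := hM m hm.le
  rw [Real.dist_eq, sub_zero, abs_of_nonneg (norm_nonneg _)]
  linarith

/-- To show that means over `[1, N]` vanish in the limit, an initial segment `[1, δ N]` with `δ`
arbitrarily small may be discarded. -/
theorem tendsto_cesaro_of_tail {N : ℕ → ℕ} (hN : Tendsto N atTop atTop)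
    {g : ℕ → ℕ → ℂ} {B : ℝ} (hg : ∀ m n, ‖g m n‖ ≤ B)
    (htail : ∀ δ : ℝ, 0 < δ → δ < 1 → ∀ᶠ m in atTop,
      ‖∑ n ∈ Finset.Ico (⌊δ * N m⌋₊ + 1) (N m + 1), g m n‖ ≤ δ * N m) :
    Tendsto (fun m => cesaro (N m) (g m)) atTop (𝓝 0) := by
  have hB : 0 ≤ B := (norm_nonneg _).trans (hg 0 0)
  rw [tendsto_zero_iff_norm_tendsto_zero, Metric.tendsto_nhds]
  intro ε hε
  obtain ⟨δ, hδ, hδ1, hδε⟩ : ∃ δ : ℝ, 0 < δ ∧ δ < 1 ∧ δ * (B + 1) < ε := by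
    refine ⟨min (1 / 2) (ε / (2 * (B + 1))), by positivity, ?_, ?_⟩
    · exact (min_le_left _ _).trans_lt (by norm_num)
    · calc _ ≤ ε / (2 * (B + 1)) * (B + 1) := by gcongr; exact min_le_right _ _
        _ = ε / 2 := by field_simp
        _ < ε := by linarith
  filter_upwards [htail δ hδ hδ1, hN.eventually_gt_atTop 0] with m hm hNm
  have hNm' : (0 : ℝ) < N m := by exact_mod_cast hNm
  rw [Real.dist_eq, sub_zero, abs_of_nonneg (norm_nonneg _)]
  refine lt_of_le_of_lt ?_ hδε
  rw [norm_cesaro, div_le_iff₀ hNm', ← Finset.Ico_succ_right_eq_Icc]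
  have hK : ⌊δ * N m⌋₊ ≤ N m := by
    have : (⌊δ * N m⌋₊ : ℝ) ≤ N m :=
      (Nat.floor_le (by positivity)).trans (by nlinarith)
    exact_mod_cast this
  rw [show Order.succ (N m) = N m + 1 from rfl,
    ← Finset.sum_Ico_consecutive _ (show 1 ≤ ⌊δ * N m⌋₊ + 1 by omega)
    (show ⌊δ * N m⌋₊ + 1 ≤ N m + 1 by omega)]
  calc _ ≤ (⌊δ * N m⌋₊ : ℝ) * B + δ * N m := by
        refine (norm_add_le _ _).trans (add_le_add ?_ hm)
        refine (norm_sum_le _ _).trans ((Finset.sum_le_sum fun n _ => hg m n).trans ?_)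
        simp
    _ ≤ (δ * N m) * B + δ * N m := by gcongr; exact Nat.floor_le (by positivity)
    _ = _ := by ring

/-! ### Exponential sums with a slowly varying phase -/

lemma norm_exp_mul_I_sub_le (a b : ℝ) :
    ‖Complex.exp (a * Complex.I) - Complex.exp (b * Complex.I)‖ ≤ |a - b| := by
  have h : Complex.exp (a * Complex.I) - Complex.exp (b * Complex.I) =
      Complex.exp (b * Complex.I) * (Complex.exp (Complex.I * ((a - b : ℝ) : ℂ)) - 1) := by
    rw [mul_sub, ← Complex.exp_add, mul_one]
    congr 2
    push_cast; ring
  rw [h, norm_mul, Complex.norm_exp_ofReal_mul_I, one_mul]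
  exact Real.norm_exp_I_mul_ofReal_sub_one_le

/-- The antiderivative `x ^ (d + 1) e^{i S θ(x)} / (i S κ)` is a good approximation to that of
`e^{i S θ(x)}` where `x ^ (d + 1) θ'(x)` is close to `κ`. -/
lemma hasDerivAt_primitive {θ : ℝ → ℝ} {θ' x κ S : ℝ} (d : ℕ) (hθ : HasDerivAt θ θ' x)
    (hκ : κ ≠ 0) (hS : S ≠ 0) :
    HasDerivAt (fun y : ℝ => ((y ^ (d + 1) : ℝ) : ℂ) *
        Complex.exp (((S * θ y : ℝ) : ℂ) * Complex.I) / (Complex.I * ((S * κ : ℝ) : ℂ)))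
      (Complex.exp (((S * θ x : ℝ) : ℂ) * Complex.I) * (((x ^ (d + 1) * θ' / κ : ℝ) : ℂ) +
        (((d + 1) * x ^ d / (S * κ) : ℝ) : ℂ) / Complex.I)) x := by
  have h1 : HasDerivAt (fun y : ℝ => ((y ^ (d + 1) : ℝ) : ℂ))
      ((((d + 1 : ℕ) : ℝ) * x ^ d : ℝ) : ℂ) x := by
    simpa using (hasDerivAt_pow (d + 1) x).ofReal_comp
  have h2 : HasDerivAt (fun y : ℝ => Complex.exp (((S * θ y : ℝ) : ℂ) * Complex.I))
      (Complex.exp (((S * θ x : ℝ) : ℂ) * Complex.I) * (((S * θ' : ℝ) : ℂ) * Complex.I)) x :=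
    ((hθ.const_mul S).ofReal_comp.mul_const Complex.I).cexp
  refine ((h1.mul h2).div_const (Complex.I * ((S * κ : ℝ) : ℂ))).congr_deriv ?_
  have hκ' : (κ : ℂ) ≠ 0 := by exact_mod_cast hκ
  have hS' : (S : ℂ) ≠ 0 := by exact_mod_cast hS
  have hI := Complex.I_ne_zero
  push_cast
  field_simp
  ring

/-- If `x ^ (d + 1) θ'(x)` has a non-zero limit at infinity and `N ^ d ≺ S ≺ N ^ (d + 1)`, then the
Cesàro means over `[1, N]` of `e^{i S θ(n)}` vanish in the limit: the derivative of the phase is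
small, while the phase itself varies a lot over `[1, N]`. -/
theorem tendsto_cesaro_exp_of_deriv {d : ℕ} {θ θ' : ℝ → ℝ} {κ : ℝ} (hκ : κ ≠ 0)
    (hθ : ∀ᶠ x in atTop, HasDerivAt θ (θ' x) x)
    (hlim : Tendsto (fun x => x ^ (d + 1) * θ' x) atTop (𝓝 κ))
    {N : ℕ → ℕ} {S : ℕ → ℝ} (hN : Tendsto N atTop atTop) (hS : ∀ᶠ m in atTop, 0 < S m)
    (hlow : Tendsto (fun m => (N m : ℝ) ^ d / S m) atTop (𝓝 0))
    (hupp : Tendsto (fun m => S m / (N m : ℝ) ^ (d + 1)) atTop (𝓝 0)) :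
    Tendsto (fun m => cesaro (N m)
      (fun n => Complex.exp (((S m * θ n : ℝ) : ℂ) * Complex.I))) atTop (𝓝 0) := by
  refine tendsto_cesaro_of_tail hN (B := 1)
    (fun m n => (Complex.norm_exp_ofReal_mul_I _).le) fun δ hδ hδ1 => ?_
  have hκ0 : 0 < |κ| := abs_pos.2 hκ
  have hlim1 : Tendsto (fun x => |x ^ (d + 1) * θ' x / κ - 1|) atTop (𝓝 0) := by
    have := ((hlim.div_const κ).sub_const 1).abs
    rwa [div_self hκ, sub_self, abs_zero] at this
  obtain ⟨X, hX⟩ := eventually_atTop.1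
    ((hθ.and (hlim1.eventually_lt_const (show (0 : ℝ) < δ / 2 by positivity))).and
      (eventually_gt_atTop 0))
  -- `A` collects the boundary terms and the correction to the primitive, `B` the variation of the
  -- phase over unit intervals
  set A : ℝ := (2 ^ (d + 2) + (d + 1) * 2 ^ d) / |κ| with hA
  set B : ℝ := 2 * |κ| / δ ^ (d + 1) with hB
  have hsmall : Tendsto (fun m => A * ((N m : ℝ) ^ d / S m) + B * (S m / (N m : ℝ) ^ (d + 1)))
      atTop (𝓝 0) := by
    simpa using (hlow.const_mul A).add (hupp.const_mul B)
  have hNr : Tendsto (fun m => δ * (N m : ℝ)) atTop atTop :=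
    (tendsto_natCast_atTop_atTop.comp hN).const_mul_atTop hδ
  filter_upwards [hsmall.eventually_lt_const (show (0 : ℝ) < δ / 2 by positivity), hS,
    hNr.eventually_ge_atTop X, hN.eventually_gt_atTop 0] with m hm hSm hXm hNm
  have hN1 : (1 : ℝ) ≤ N m := by exact_mod_cast hNm
  have hN0 : (0 : ℝ) < N m := by linarith
  set K := ⌊δ * N m⌋₊ + 1 with hK
  have hKδ : δ * N m ≤ K := by
    rw [hK]; push_cast; exact (Nat.lt_floor_add_one _).le
  have hKN : K ≤ N m + 1 := by
    have : (⌊δ * N m⌋₊ : ℝ) ≤ N m := (Nat.floor_le (by positivity)).trans (by nlinarith)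
    have : ⌊δ * N m⌋₊ ≤ N m := by exact_mod_cast this
    omega
  set u : ℝ → ℂ := fun x => Complex.exp (((S m * θ x : ℝ) : ℂ) * Complex.I) with hu
  have hu1 : ∀ x, ‖u x‖ = 1 := fun x => Complex.norm_exp_ofReal_mul_I _
  set G : ℝ → ℂ := fun y => ((y ^ (d + 1) : ℝ) : ℂ) * u y / (Complex.I * ((S m * κ : ℝ) : ℂ))
    with hG
  have hGnorm : ∀ x : ℝ, 0 ≤ x → x ≤ 2 * N m →
      ‖G x‖ ≤ 2 ^ (d + 1) * N m ^ (d + 1) / (S m * |κ|) := by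
    intro x hx hx2
    rw [hG]
    simp only [norm_div, norm_mul, hu1, Complex.norm_I, Complex.norm_real, Real.norm_eq_abs,
      abs_of_pos hSm, one_mul, mul_one, abs_of_nonneg (pow_nonneg hx (d + 1))]
    rw [← mul_pow]
    gcongr
  -- the phase is almost constant on intervals of length one
  have hθ'bd : ∀ x, δ * N m ≤ x → |θ' x| ≤ 2 * |κ| / (δ * N m) ^ (d + 1) := by
    intro x hx
    have hx0 : 0 < x := lt_of_lt_of_le (by positivity) hx
    have h1 := (hX x (hXm.trans hx)).1.2
    have h2 : |x ^ (d + 1) * θ' x / κ| ≤ 2 := by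
      have := abs_sub_abs_le_abs_sub (x ^ (d + 1) * θ' x / κ) 1
      rw [abs_one] at this
      linarith
    rw [abs_div, abs_mul, abs_of_pos (pow_pos hx0 _), div_le_iff₀ hκ0] at h2
    rw [le_div_iff₀ (by positivity)]
    calc _ ≤ |θ' x| * x ^ (d + 1) := by gcongr
      _ ≤ _ := by linarith
  set E : ℝ := δ / 2 + (d + 1) * (2 * N m) ^ d / (S m * |κ|) +
    S m * (2 * |κ| / (δ * N m) ^ (d + 1)) with hE
  have hstep : ∀ n ∈ Finset.Ico K (N m + 1), ‖(G ((n + 1 : ℕ) : ℝ) - G n) - u n‖ ≤ E := by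
    intro n hn
    rw [Finset.mem_Ico] at hn
    have hnK : δ * N m ≤ n := hKδ.trans (by exact_mod_cast hn.1)
    have hnN : (n : ℝ) ≤ N m := by exact_mod_cast Nat.lt_succ_iff.1 hn.2
    have hIcc : ∀ x ∈ Set.Icc (n : ℝ) (n + 1), HasDerivAt θ (θ' x) x := fun x hx =>
      (hX x (hXm.trans (hnK.trans hx.1))).1.1
    have hvar : ∀ x ∈ Set.Icc (n : ℝ) (n + 1), ‖u x - u n‖ ≤
        S m * (2 * |κ| / (δ * N m) ^ (d + 1)) := by
      intro x hx
      refine (norm_exp_mul_I_sub_le _ _).trans ?_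
      rw [← mul_sub, abs_mul, abs_of_pos hSm]
      refine mul_le_mul_of_nonneg_left ?_ hSm.le
      have := (convex_Icc (n : ℝ) (n + 1)).norm_image_sub_le_of_norm_hasDerivWithin_le
        (fun y hy => (hIcc y hy).hasDerivWithinAt)
        (fun y hy => hθ'bd y (hnK.trans hy.1)) (Set.left_mem_Icc.2 (by linarith)) hx
      refine this.trans ?_
      rw [Real.norm_eq_abs, abs_of_nonneg (show 0 ≤ x - n by linarith [hx.1])]
      exact mul_le_of_le_one_right (by positivity) (by linarith [hx.2])
    have := (convex_Icc (n : ℝ) (n + 1)).norm_image_sub_le_of_norm_hasDerivWithin_le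
      (f := fun y : ℝ => G y - (y : ℂ) * u n) (C := E) (x := (n : ℝ)) (y := (n : ℝ) + 1)
      (fun y hy => ((hasDerivAt_primitive d (hIcc y hy) hκ hSm.ne').sub
        ((Complex.ofRealCLM.hasDerivAt (x := y)).mul_const (u n))).hasDerivWithinAt)
      ?_ (Set.left_mem_Icc.2 (by linarith)) (Set.right_mem_Icc.2 (by linarith))
    · rw [show (n : ℝ) + 1 - n = 1 by ring, norm_one, mul_one] at this
      refine le_trans (le_of_eq ?_) this
      congr 1
      push_cast
      ring
    · intro y hy
      have hy0 : 0 < y := lt_of_lt_of_le (by positivity) (hnK.trans hy.1)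
      have hr := (hX y (hXm.trans (hnK.trans hy.1))).1.2
      set r := y ^ (d + 1) * θ' y / κ with hr'
      have hdec : u y * ((r : ℂ) + (((d + 1) * y ^ d / (S m * κ) : ℝ) : ℂ) / Complex.I) -
          Complex.ofRealCLM 1 * u n = u y * ((r - 1 : ℝ) : ℂ) +
            u y * ((((d + 1) * y ^ d / (S m * κ) : ℝ) : ℂ) / Complex.I) + (u y - u n) := by
        simp only [Complex.ofRealCLM_apply]; push_cast; ring
      change ‖u y * ((r : ℂ) + (((d + 1) * y ^ d / (S m * κ) : ℝ) : ℂ) / Complex.I) -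
          Complex.ofRealCLM 1 * u n‖ ≤ E
      rw [hdec, hE]
      refine (norm_add₃_le).trans (add_le_add (add_le_add ?_ ?_) (hvar y hy))
      · rw [norm_mul, hu1, one_mul, Complex.norm_real]; exact hr.le
      · rw [norm_mul, hu1, one_mul, norm_div, Complex.norm_I, div_one, Complex.norm_real,
          Real.norm_eq_abs, abs_div, abs_mul (S m), abs_of_pos hSm,
          abs_of_nonneg (show 0 ≤ ((d : ℝ) + 1) * y ^ d by positivity)]
        have : y ≤ 2 * N m := by linarith [hy.2]
        gcongr
  -- telescoping
  have hsum : ‖∑ n ∈ Finset.Ico K (N m + 1), u n‖ ≤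
      2 * (2 ^ (d + 1) * N m ^ (d + 1) / (S m * |κ|)) + N m * E := by
    have h1 : ∑ n ∈ Finset.Ico K (N m + 1), u n = (G ((N m + 1 : ℕ) : ℝ) - G K) -
        ∑ n ∈ Finset.Ico K (N m + 1), ((G ((n + 1 : ℕ) : ℝ) - G n) - u n) := by
      rw [Finset.sum_sub_distrib, Finset.sum_Ico_sub (fun n : ℕ => G n) hKN]
      ring
    rw [h1]
    refine (norm_sub_le _ _).trans (add_le_add ((norm_sub_le _ _).trans ?_) ?_)
    · rw [two_mul]
      refine add_le_add (hGnorm _ (by positivity) ?_) (hGnorm _ (by positivity) ?_)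
      · push_cast; linarith
      · have : (K : ℝ) ≤ N m + 1 := by exact_mod_cast hKN
        linarith
    · refine (norm_sum_le _ _).trans ((Finset.sum_le_sum hstep).trans ?_)
      rw [Finset.sum_const, Nat.card_Ico, nsmul_eq_mul]
      have : ((N m + 1 - K : ℕ) : ℝ) ≤ N m := by exact_mod_cast (by omega)
      gcongr
  refine hsum.trans ?_
  have hid : 2 * (2 ^ (d + 1) * (N m : ℝ) ^ (d + 1) / (S m * |κ|)) + N m * E =
      N m * (δ / 2 + (A * ((N m : ℝ) ^ d / S m) + B * (S m / (N m : ℝ) ^ (d + 1)))) := by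
    rw [hE, hA, hB]
    field_simp
    ring
  rw [hid, mul_comm δ]
  gcongr
  linarith

/-! ### Logarithmic phases and moments -/

/-- The phase `∑ⱼ εⱼ log (x + hⱼ)` of the correlation `∏ⱼ (x + hⱼ) ^ {i εⱼ}`. -/
def logPhase {ι : Type} [Fintype ι] (ε h : ι → ℤ) (x : ℝ) : ℝ :=
  ∑ j, (ε j : ℝ) * Real.log (x + h j)

/-- The `i`-th moment `∑ⱼ εⱼ hⱼ ^ i` of the weights `εⱼ` placed at the integers `hⱼ`. -/
def weightedMoment {ι : Type} [Fintype ι] (ε h : ι → ℤ) (i : ℕ) : ℤ := ∑ j, ε j * h j ^ i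

section LogPhase

variable {ι : Type} [Fintype ι] {ε h : ι → ℤ} {d : ℕ}

lemma eventually_forall_add_pos (h : ι → ℤ) : ∀ᶠ x : ℝ in atTop, ∀ j, 0 < x + h j := by
  rw [eventually_all]
  intro j
  filter_upwards [eventually_gt_atTop (-(h j : ℝ))] with x hx
  linarith

lemma hasDerivAt_logPhase {x : ℝ} (hx : ∀ j, 0 < x + h j) :
    HasDerivAt (logPhase ε h) (∑ j, (ε j : ℝ) / (x + h j)) x := by
  unfold logPhase
  refine HasDerivAt.fun_sum fun j _ => ?_
  have := (((hasDerivAt_id x).add_const (h j : ℝ)).log (hx j).ne').const_mul (ε j : ℝ)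
  simpa [div_eq_mul_inv] using this

lemma pow_div_add_eq {x y : ℝ} (hxy : x + y ≠ 0) (d : ℕ) :
    x ^ (d + 1) / (x + y) =
      ∑ i ∈ Finset.range (d + 1), (-y) ^ i * x ^ (d - i) + (-y) ^ (d + 1) / (x + y) := by
  have := (Commute.all (-y) x).geom_sum₂_mul (d + 1)
  simp only [Nat.add_sub_cancel] at this
  field_simp
  linear_combination this

/-- The first non-vanishing moment governs the size of the derivative of the phase. -/
lemma tendsto_pow_mul_deriv_logPhase (hm : ∀ i < d, weightedMoment ε h i = 0) :
    Tendsto (fun x : ℝ => x ^ (d + 1) * ∑ j, (ε j : ℝ) / (x + h j)) atTop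
      (𝓝 ((-1) ^ d * (weightedMoment ε h d : ℝ))) := by
  have hrem : Tendsto (fun x : ℝ => (-1) ^ d * (weightedMoment ε h d : ℝ) +
      ∑ j, (ε j : ℝ) * ((-(h j : ℝ)) ^ (d + 1) / (x + h j))) atTop
      (𝓝 ((-1) ^ d * (weightedMoment ε h d : ℝ) + ∑ j : ι, (ε j : ℝ) * 0)) := by
    refine tendsto_const_nhds.add (tendsto_finsetSum _ fun j _ => Tendsto.const_mul _ ?_)
    exact (tendsto_atTop_add_const_right _ _ tendsto_id).const_div_atTop _
  simp only [mul_zero, Finset.sum_const_zero, add_zero] at hrem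
  refine hrem.congr' ?_
  filter_upwards [eventually_forall_add_pos h] with x hx
  have h1 : ∀ j, x ^ (d + 1) * ((ε j : ℝ) / (x + h j)) =
      ∑ i ∈ Finset.range (d + 1), ((-1) ^ i * x ^ (d - i)) * ((ε j : ℝ) * (h j : ℝ) ^ i) +
        (ε j : ℝ) * ((-(h j : ℝ)) ^ (d + 1) / (x + h j)) := by
    intro j
    rw [mul_div_left_comm, pow_div_add_eq (hx j).ne', mul_add, Finset.mul_sum]
    congr 1
    refine Finset.sum_congr rfl fun i _ => ?_
    rw [neg_pow]; ring
  rw [Finset.mul_sum, Finset.sum_congr rfl fun j _ => h1 j, Finset.sum_add_distrib,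
    Finset.sum_comm]
  congr 1
  simp_rw [← Finset.mul_sum]
  have h2 : ∀ i, ∑ j, (ε j : ℝ) * (h j : ℝ) ^ i = (weightedMoment ε h i : ℝ) := by
    intro i; simp [weightedMoment]
  simp_rw [h2]
  rw [Finset.sum_range_succ, Finset.sum_eq_zero, zero_add, Nat.sub_self, pow_zero, mul_one]
  intro i hi
  rw [hm i (Finset.mem_range.1 hi)]; simp

/-- If the moments of order at most `d` all vanish then the phase is `O(x ^ {-(d + 1)})`. -/
lemma exists_abs_logPhase_le (hm : ∀ i ≤ d, weightedMoment ε h i = 0) :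
    ∃ C X : ℝ, 0 ≤ C ∧ ∀ x : ℝ, X ≤ x → |logPhase ε h x| ≤ C / x ^ (d + 1) := by
  set M : ℝ := ∑ j, |(h j : ℝ)| with hM
  have hM0 : 0 ≤ M := Finset.sum_nonneg fun _ _ => abs_nonneg _
  have hjM : ∀ j, |(h j : ℝ)| ≤ M := fun j =>
    Finset.single_le_sum (f := fun j => |(h j : ℝ)|) (fun _ _ => abs_nonneg _) (Finset.mem_univ j)
  -- for `x ≥ 2 M + 1` all ratios `hⱼ / x` are at most `1 / 2`, and the Taylor expansion of order `d`
  -- of `log (1 + hⱼ / x)` is cancelled by the vanishing moments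
  refine ⟨∑ j, |(ε j : ℝ)| * (2 * M ^ (d + 1)), 2 * M + 1,
    Finset.sum_nonneg fun _ _ => by positivity, fun x hx => ?_⟩
  have hx0 : 0 < x := by linarith
  have hratio : ∀ j, |-(h j : ℝ) / x| ≤ M / x := fun j => by
    rw [abs_div, abs_neg, abs_of_pos hx0]; gcongr; exact hjM j
  have hMx : M / x ≤ 1 / 2 := by rw [div_le_iff₀ hx0]; linarith
  set T : ι → ℝ := fun j => ∑ i ∈ Finset.range d, (-(h j : ℝ) / x) ^ (i + 1) / ((i : ℝ) + 1)
  have hlog : ∀ j, |T j + Real.log (1 - -(h j : ℝ) / x)| ≤ 2 * (M / x) ^ (d + 1) := by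
    intro j
    have h1 := hratio j
    refine (Real.abs_log_sub_add_sum_range_le (by linarith) d).trans ?_
    rw [div_le_iff₀ (by linarith)]
    have h2 : |-(h j : ℝ) / x| ^ (d + 1) ≤ (M / x) ^ (d + 1) := by gcongr
    have h3 : 0 ≤ (M / x) ^ (d + 1) := by positivity
    nlinarith
  have hT : ∑ j, (ε j : ℝ) * T j = 0 := by
    simp only [T, Finset.mul_sum]
    rw [Finset.sum_comm]
    refine Finset.sum_eq_zero fun i hi => ?_
    have : ∀ j, (ε j : ℝ) * ((-(h j : ℝ) / x) ^ (i + 1) / ((i : ℝ) + 1)) =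
        ((-1 / x) ^ (i + 1) / ((i : ℝ) + 1)) * ((ε j * h j ^ (i + 1) : ℤ) : ℝ) := by
      intro j
      rw [show -(h j : ℝ) / x = (-1 / x) * h j by ring, mul_pow]; push_cast; ring
    simp_rw [this]
    have h0 := hm (i + 1) (Finset.mem_range.1 hi)
    rw [weightedMoment] at h0
    rw [← Finset.mul_sum, ← Int.cast_sum, h0, Int.cast_zero, mul_zero]
  have h0 : ∑ j, (ε j : ℝ) = 0 := by
    have := hm 0 (Nat.zero_le _)
    simp only [weightedMoment, pow_zero, mul_one] at this
    exact_mod_cast this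
  have hexp : logPhase ε h x = ∑ j, (ε j : ℝ) * (T j + Real.log (1 - -(h j : ℝ) / x)) := by
    simp only [mul_add, Finset.sum_add_distrib, hT, zero_add, logPhase]
    have : ∀ j, Real.log (x + h j) = Real.log x + Real.log (1 - -(h j : ℝ) / x) := by
      intro j
      have hpos : 0 < 1 - -(h j : ℝ) / x := by
        have := (le_abs_self _).trans (hratio j); linarith
      rw [← Real.log_mul hx0.ne' hpos.ne']
      congr 1; field_simp; ring
    simp_rw [this, mul_add, Finset.sum_add_distrib, ← Finset.sum_mul, h0, zero_mul, zero_add]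
  rw [hexp, Finset.sum_div]
  refine (Finset.abs_sum_le_sum_abs _ _).trans (Finset.sum_le_sum fun j _ => ?_)
  rw [abs_mul, mul_div_assoc, mul_div_assoc, ← div_pow]
  gcongr
  exact hlog j

/-- The Cesàro means of a correlation whose moments of order at most `d` vanish tend to `1`. -/
theorem tendsto_cesaro_logPhase_one (hm : ∀ i ≤ d, weightedMoment ε h i = 0)
    {N : ℕ → ℕ} {S : ℕ → ℝ} (hN : Tendsto N atTop atTop) (hS : ∀ᶠ m in atTop, 0 < S m)
    (hupp : Tendsto (fun m => S m / (N m : ℝ) ^ (d + 1)) atTop (𝓝 0)) :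
    Tendsto (fun m => cesaro (N m)
      (fun n => Complex.exp (((S m * logPhase ε h n : ℝ) : ℂ) * Complex.I))) atTop (𝓝 1) := by
  obtain ⟨C, X, hC, hCX⟩ := exists_abs_logPhase_le hm
  have key : Tendsto (fun m => cesaro (N m)
      (fun n => Complex.exp (((S m * logPhase ε h n : ℝ) : ℂ) * Complex.I) - 1)) atTop (𝓝 0) := by
    refine tendsto_cesaro_of_tail hN (B := 2) (fun m n => ?_) fun δ hδ hδ1 => ?_
    · refine (norm_sub_le _ _).trans ?_
      rw [Complex.norm_exp_ofReal_mul_I, norm_one]; norm_num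
    have hsmall : Tendsto (fun m => C / δ ^ (d + 1) * (S m / (N m : ℝ) ^ (d + 1)))
        atTop (𝓝 0) := by simpa using hupp.const_mul (C / δ ^ (d + 1))
    have hNr : Tendsto (fun m => δ * (N m : ℝ)) atTop atTop :=
      (tendsto_natCast_atTop_atTop.comp hN).const_mul_atTop hδ
    filter_upwards [hsmall.eventually_lt_const hδ, hS, hNr.eventually_ge_atTop X,
      hN.eventually_gt_atTop 0] with m hm hSm hXm hNm
    have hN0 : (0 : ℝ) < N m := by exact_mod_cast hNm
    have hterm : ∀ n ∈ Finset.Ico (⌊δ * N m⌋₊ + 1) (N m + 1),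
        ‖Complex.exp (((S m * logPhase ε h n : ℝ) : ℂ) * Complex.I) - 1‖ ≤ δ := by
      intro n hn
      have hn' : δ * N m ≤ n := by
        have : ((⌊δ * N m⌋₊ + 1 : ℕ) : ℝ) ≤ n := by exact_mod_cast (Finset.mem_Ico.1 hn).1
        push_cast at this
        exact (Nat.lt_floor_add_one _).le.trans this
      have h1 := norm_exp_mul_I_sub_le (S m * logPhase ε h n) 0
      simp only [Complex.ofReal_zero, zero_mul, Complex.exp_zero, sub_zero] at h1
      refine h1.trans (le_trans ?_ hm.le)
      rw [abs_mul, abs_of_pos hSm]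
      calc _ ≤ S m * (C / (n : ℝ) ^ (d + 1)) := by gcongr; exact hCX _ (hXm.trans hn')
        _ ≤ S m * (C / (δ * N m) ^ (d + 1)) := by gcongr
        _ = _ := by rw [mul_pow]; field_simp
    refine (norm_sum_le _ _).trans ((Finset.sum_le_sum hterm).trans ?_)
    rw [Finset.sum_const, Nat.card_Ico, nsmul_eq_mul, mul_comm]
    have : ((N m + 1 - (⌊δ * N m⌋₊ + 1) : ℕ) : ℝ) ≤ N m := by exact_mod_cast (by omega)
    gcongr
  have := key.add_const 1
  rw [zero_add] at this
  refine this.congr' ?_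
  filter_upwards [hN.eventually_gt_atTop 0] with m hm
  rw [cesaro_sub, cesaro_const hm.ne', sub_add_cancel]

/-- Differencing a correlation raises the order of the first non-vanishing moment by one. -/
lemma weightedMoment_difference {k : ℕ} (hm : ∀ i < k, weightedMoment ε h i = 0) (a b : ℤ) :
    (∀ i ≤ k, weightedMoment (Sum.elim ε (-ε)) (Sum.elim (fun j => h j + a) (fun j => h j + b)) i
      = 0) ∧
    weightedMoment (Sum.elim ε (-ε)) (Sum.elim (fun j => h j + a) (fun j => h j + b)) (k + 1) =
      (k + 1) * (a - b) * weightedMoment ε h k := by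
  have hexp : ∀ i : ℕ, weightedMoment (Sum.elim ε (-ε))
      (Sum.elim (fun j => h j + a) (fun j => h j + b)) i =
      ∑ l ∈ Finset.range i, ((a ^ (i - l) - b ^ (i - l)) * i.choose l) * weightedMoment ε h l := by
    intro i
    have h1 : ∀ c : ℤ, ∑ j, ε j * (h j + c) ^ i =
        ∑ l ∈ Finset.range (i + 1), (c ^ (i - l) * i.choose l) * weightedMoment ε h l := by
      intro c
      simp only [add_pow, weightedMoment, Finset.mul_sum]
      rw [Finset.sum_comm]
      refine Finset.sum_congr rfl fun l _ => Finset.sum_congr rfl fun j _ => by ring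
    simp only [weightedMoment, Fintype.sum_sum_type, Sum.elim_inl, Sum.elim_inr, Pi.neg_apply,
      neg_mul, Finset.sum_neg_distrib]
    rw [h1, h1, ← sub_eq_add_neg, ← Finset.sum_sub_distrib, Finset.sum_range_succ]
    simp only [Nat.sub_self, pow_zero, sub_self, add_zero, weightedMoment]
    refine Finset.sum_congr rfl fun l _ => by ring
  refine ⟨fun i hi => ?_, ?_⟩
  · rw [hexp]
    refine Finset.sum_eq_zero fun l hl => ?_
    rw [hm l ((Finset.mem_range.1 hl).trans_le hi), mul_zero]
  · rw [hexp, Finset.sum_range_succ, Finset.sum_eq_zero, zero_add]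
    · rw [Nat.add_sub_cancel_left, Nat.choose_succ_self_right]; push_cast; ring
    · intro l hl
      rw [hm l (Finset.mem_range.1 hl), mul_zero]

lemma logPhase_difference (a b : ℕ) (x : ℝ) :
    logPhase (Sum.elim ε (-ε)) (Sum.elim (fun j => h j + a) (fun j => h j + b)) x =
      logPhase ε h (x + a) - logPhase ε h (x + b) := by
  simp only [logPhase, Fintype.sum_sum_type, Sum.elim_inl, Sum.elim_inr, Pi.neg_apply]
  push_cast
  simp only [neg_mul, Finset.sum_neg_distrib, ← sub_eq_add_neg]
  congr 1 <;> refine Finset.sum_congr rfl fun j _ => ?_ <;> congr 2 <;> ring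

end LogPhase

/-- The Cesàro means of a correlation with a non-vanishing moment of order at most `d` tend to `0`.
The order of the first such moment is raised to `d` by repeated differencing, whereupon
the derivative of the phase becomes small. -/
theorem tendsto_cesaro_logPhase_zero {d : ℕ} {N : ℕ → ℕ} {S : ℕ → ℝ}
    (hN : Tendsto N atTop atTop) (hS : ∀ᶠ m in atTop, 0 < S m)
    (hlow : Tendsto (fun m => (N m : ℝ) ^ d / S m) atTop (𝓝 0))
    (hupp : Tendsto (fun m => S m / (N m : ℝ) ^ (d + 1)) atTop (𝓝 0))
    {ι : Type} [Fintype ι] {ε h : ι → ℤ} (hne : ∃ i ≤ d, weightedMoment ε h i ≠ 0) :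
    Tendsto (fun m => cesaro (N m)
      (fun n => Complex.exp (((S m * logPhase ε h n : ℝ) : ℂ) * Complex.I))) atTop (𝓝 0) := by
  have key : ∀ r k : ℕ, r + k = d → ∀ (ι : Type) [Fintype ι] (ε h : ι → ℤ),
      (∀ i < k, weightedMoment ε h i = 0) → weightedMoment ε h k ≠ 0 →
      Tendsto (fun m => cesaro (N m)
        (fun n => Complex.exp (((S m * logPhase ε h n : ℝ) : ℂ) * Complex.I))) atTop (𝓝 0) := by
    intro r
    induction r with
    | zero =>
      rintro k hk ι _ ε h hm hm0
      obtain rfl : k = d := by omega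
      refine tendsto_cesaro_exp_of_deriv (κ := (-1) ^ k * (weightedMoment ε h k : ℝ)) ?_ ?_
        (tendsto_pow_mul_deriv_logPhase hm) hN hS hlow hupp
      · exact mul_ne_zero (by simp) (by exact_mod_cast hm0)
      · filter_upwards [eventually_forall_add_pos h] with x hx
        exact hasDerivAt_logPhase hx
    | succ r ih =>
      rintro k hk ι _ ε h hm hm0
      refine tendsto_cesaro_of_correlations hN
        (fun m n => (Complex.norm_exp_ofReal_mul_I _).le) fun a b hab => ?_
      obtain ⟨h1, h2⟩ := weightedMoment_difference hm (a : ℤ) (b : ℤ)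
      refine (ih (k + 1) (by omega) _ _ _ (fun i hi => h1 i (Nat.lt_succ_iff.1 hi)) ?_).congr
        fun m => ?_
      · rw [h2]
        refine mul_ne_zero (mul_ne_zero (by positivity) (sub_ne_zero.2 ?_)) hm0
        exact_mod_cast hab
      · congr 1
        funext n
        rw [logPhase_difference, ← Complex.exp_conj, ← Complex.exp_add]
        congr 1
        simp only [map_mul, Complex.conj_ofReal, Complex.conj_I]
        push_cast
        ring
  classical
  have hk := Nat.find_spec hne
  refine key (d - Nat.find hne) (Nat.find hne) (by omega) ι ε h (fun i hi => ?_) hk.2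
  have := Nat.find_min hne hi
  push Not at this
  exact this (by omega)

/-! ### Approximating an MRT function by an Archimedean character -/

lemma norm_mul_sub_mul_le {z w z' w' : ℂ} (hz : ‖z‖ ≤ 1) (hw' : ‖w'‖ ≤ 1) :
    ‖z * w - z' * w'‖ ≤ ‖z - z'‖ + ‖w - w'‖ := by
  calc ‖z * w - z' * w'‖ = ‖z * (w - w') + (z - z') * w'‖ := by congr 1; ring
    _ ≤ ‖z‖ * ‖w - w'‖ + ‖z - z'‖ * ‖w'‖ := by
        rw [← norm_mul, ← norm_mul]; exact norm_add_le _ _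
    _ ≤ 1 * ‖w - w'‖ + ‖z - z'‖ * 1 := by gcongr
    _ = _ := by ring

lemma norm_prod_sub_prod_le_sum {ι : Type*} (I : Finset ι) {z w : ι → ℂ}
    (hz : ∀ j, ‖z j‖ ≤ 1) (hw : ∀ j, ‖w j‖ ≤ 1) :
    ‖∏ j ∈ I, z j - ∏ j ∈ I, w j‖ ≤ ∑ j ∈ I, ‖z j - w j‖ := by
  classical
  induction I using Finset.induction_on with
  | empty => simp
  | insert j I hj ih =>
    rw [Finset.prod_insert hj, Finset.prod_insert hj, Finset.sum_insert hj]
    refine (norm_mul_sub_mul_le (hz j) ?_).trans (by gcongr)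
    rw [norm_prod]
    exact Finset.prod_le_one (fun _ _ => norm_nonneg _) fun j _ => hw j

lemma natCast_cpow_I_mul {p : ℕ} (hp : p ≠ 0) (s : ℤ) :
    (p : ℂ) ^ (Complex.I * (s : ℂ)) =
      Complex.exp ((((s : ℝ) * Real.log p : ℝ) : ℂ) * Complex.I) := by
  rw [Complex.cpow_def_of_ne_zero (by exact_mod_cast hp), ← Complex.natCast_log]
  congr 1
  push_cast
  ring

lemma sum_factorization_prime {p : ℕ} (hp : p.Prime) (T : ℕ) :
    ∑ q ∈ Finset.Icc 1 T, p.factorization q = if p ≤ T then 1 else 0 := by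
  simp [hp.factorization, Finsupp.single_apply, hp.one_lt.le]

lemma sum_factorization_le (N T : ℕ) :
    ∑ n ∈ Finset.Icc 1 N, ∑ p ∈ Finset.Icc 1 T, n.factorization p ≤ T * N := by
  rw [Finset.sum_comm]
  calc _ ≤ ∑ p ∈ Finset.Icc 1 T, N := by
        refine Finset.sum_le_sum fun p _ => ?_
        have h : ∑ n ∈ Finset.Icc 1 N, n.factorization p = (N.factorial).factorization p := by
          induction N with
          | zero => simp
          | succ N ih =>
            rw [Finset.sum_Icc_succ_top (by omega), ih, Nat.factorial_succ,
              Nat.factorization_mul (by omega) (Nat.factorial_ne_zero N), Finsupp.add_apply,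
              add_comm]
        rw [h]
        by_cases hp : p.Prime
        · exact (Nat.factorization_factorial_le_div_pred hp N).trans (Nat.div_le_self _ _)
        · rw [Nat.factorization_eq_zero_of_not_prime _ hp]; exact Nat.zero_le _
    _ = _ := by simp

namespace IsMRTWith

variable {f : ℕ+ →* Circle} {t s : ℕ → ℤ}

lemma le_t (hf : IsMRTWith f t s) {m : ℕ} (hm : 1 ≤ m) : (m : ℤ) ≤ t m := by
  induction m, hm using Nat.le_induction with
  | base => simp [hf.t_one]
  | succ m hm ih =>
    have := hf.t_strictMono (Set.mem_Ici.2 hm) (Set.mem_Ici.2 (by omega)) (Nat.lt_succ_self m)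
    push_cast
    simp only [Nat.succ_eq_add_one] at this
    omega

lemma lt_s_succ (hf : IsMRTWith f t s) {m : ℕ} (hm : 1 ≤ m) : (m : ℤ) < s (m + 1) :=
  (hf.le_t hm).trans_lt (hf.growth m hm).1

/-- Up to `t (m + 1)`, the distance of `f n` from `n ^ {i s (m + 1)}` is at most `1 / (t m) ^ 2` for
each prime factor of `n` not exceeding `t m`, counted with multiplicity. -/
lemma norm_sub_exp_le (hf : IsMRTWith f t s) {m : ℕ} (hm : 1 ≤ m) (n : ℕ) :
    ∀ hn : 0 < n, (n : ℤ) ≤ t (m + 1) →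
      ‖(f (⟨n, hn⟩ : ℕ+) : ℂ) - Complex.exp ((((s (m + 1) : ℝ) * Real.log n : ℝ) : ℂ) * Complex.I)‖ ≤
        (∑ p ∈ Finset.Icc 1 (t m).toNat, n.factorization p : ℕ) * (1 / (t m : ℝ) ^ 2) := by
  induction n using induction_on_primes with
  | zero => intro hn; exact absurd hn (lt_irrefl _)
  | one =>
    intro hn _
    simp
  | prime_mul p a hp ih =>
    intro hn hle
    have ha : 0 < a := Nat.pos_of_mul_pos_left hn
    have hpa : ((p * a : ℕ) : ℤ) = p * a := by push_cast; ring
    have hp1 : (1 : ℤ) ≤ p := by exact_mod_cast hp.one_lt.le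
    have ha1 : (1 : ℤ) ≤ a := by exact_mod_cast ha
    have hlea : (a : ℤ) ≤ t (m + 1) := le_trans (by rw [hpa]; nlinarith) hle
    have hlep : (p : ℤ) ≤ t (m + 1) := le_trans (by rw [hpa]; nlinarith) hle
    have hfm : f (⟨p * a, hn⟩ : ℕ+) = f (⟨p, hp.pos⟩ : ℕ+) * f (⟨a, ha⟩ : ℕ+) :=
      map_mul f (⟨p, hp.pos⟩ : ℕ+) (⟨a, ha⟩ : ℕ+)
    have hexp : Complex.exp ((((s (m + 1) : ℝ) * Real.log ((p * a : ℕ) : ℝ) : ℝ) : ℂ) * Complex.I)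
        = Complex.exp ((((s (m + 1) : ℝ) * Real.log p : ℝ) : ℂ) * Complex.I) *
          Complex.exp ((((s (m + 1) : ℝ) * Real.log a : ℝ) : ℂ) * Complex.I) := by
      rw [← Complex.exp_add, Nat.cast_mul, Real.log_mul (by exact_mod_cast hp.ne_zero)
        (by exact_mod_cast ha.ne')]
      congr 1
      push_cast
      ring
    rw [hfm, hexp, Circle.coe_mul]
    refine (norm_mul_sub_mul_le (Circle.norm_coe _).le
      (Complex.norm_exp_ofReal_mul_I _).le).trans ?_
    have hfac : ∑ q ∈ Finset.Icc 1 (t m).toNat, (p * a).factorization q =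
        (if p ≤ (t m).toNat then 1 else 0) +
          ∑ q ∈ Finset.Icc 1 (t m).toNat, a.factorization q := by
      rw [← sum_factorization_prime hp, ← Finset.sum_add_distrib, Nat.factorization_mul
        hp.ne_zero ha.ne']
      rfl
    rw [hfac, Nat.cast_add, add_mul]
    refine add_le_add ?_ (ih ha hlea)
    have htm := hf.le_t hm
    rw [← natCast_cpow_I_mul hp.ne_zero]
    split_ifs with hpt
    · rw [Nat.cast_one, one_mul]
      exact hf.approx_on_small m hm ⟨p, hp.pos⟩ hp (by simp only [PNat.mk_coe]; omega)
    · have := hf.eq_on_large m hm ⟨p, hp.pos⟩ hp (by simp only [PNat.mk_coe]; omega) hlep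
      rw [this]
      simp

/-- The mean distance of `f n` from `n ^ {i s (m + 1)}` over `n ≤ N` is at most `1 / t m`, since each
prime divides `N!` to a power at most `N`. -/
lemma sum_norm_sub_exp_le (hf : IsMRTWith f t s) {m : ℕ} (hm : 1 ≤ m) {N : ℕ}
    (hN : (N : ℤ) ≤ t (m + 1)) {a : SeqSpace}
    (ha : ∀ n : ℕ+, (a ((n : ℕ) : ℤ) : ℂ) = (f n : ℂ)) :
    ∑ n ∈ Finset.Icc 1 N, ‖(a (n : ℤ) : ℂ) -
      Complex.exp ((((s (m + 1) : ℝ) * Real.log n : ℝ) : ℂ) * Complex.I)‖ ≤ N / (t m : ℝ) := by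
  have htm : (0 : ℝ) < t m := by exact_mod_cast (by have := hf.le_t hm; omega : (0 : ℤ) < t m)
  have hT : (((t m).toNat : ℕ) : ℝ) = t m := by
    have : ((t m).toNat : ℤ) = t m := Int.toNat_of_nonneg (by exact_mod_cast htm.le)
    exact_mod_cast this
  calc _ ≤ ∑ n ∈ Finset.Icc 1 N,
        (∑ p ∈ Finset.Icc 1 (t m).toNat, n.factorization p : ℕ) * (1 / (t m : ℝ) ^ 2) := by
        refine Finset.sum_le_sum fun n hn => ?_
        obtain ⟨h1, h2⟩ := Finset.mem_Icc.1 hn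
        have := hf.norm_sub_exp_le hm n h1 (le_trans (by exact_mod_cast h2) hN)
        rwa [← ha ⟨n, h1⟩] at this
    _ = (∑ n ∈ Finset.Icc 1 N, ∑ p ∈ Finset.Icc 1 (t m).toNat, n.factorization p : ℕ) *
        (1 / (t m : ℝ) ^ 2) := by rw [← Finset.sum_mul]; push_cast; rfl
    _ ≤ (((t m).toNat * N : ℕ) : ℝ) * (1 / (t m : ℝ) ^ 2) := by
        gcongr; exact sum_factorization_le _ _
    _ = N / (t m : ℝ) := by
        rw [Nat.cast_mul, hT]; field_simp

end IsMRTWith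

lemma sum_shift_le {u : ℤ → ℝ} {B : ℝ} (hu : ∀ k, 0 ≤ u k) (huB : ∀ k, u k ≤ B) (N : ℕ) (h : ℤ) :
    ∑ n ∈ Finset.Icc 1 N, u (n + h) ≤ ∑ n ∈ Finset.Icc 1 N, u n + B * |(h : ℝ)| := by
  have hB : 0 ≤ B := (hu 0).trans (huB 0)
  have step : ∀ h : ℤ, ∑ n ∈ Finset.Icc 1 N, u (n + (h + 1)) - ∑ n ∈ Finset.Icc 1 N, u (n + h) =
      u (N + 1 + h) - u (1 + h) := by
    intro h
    rw [← Finset.sum_sub_distrib, ← Finset.Ico_succ_right_eq_Icc]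
    have := Finset.sum_Ico_sub (fun n : ℕ => u (n + h)) (show 1 ≤ N + 1 by omega)
    push_cast at this
    rw [← this]
    refine Finset.sum_congr rfl fun n _ => ?_
    rw [show (n : ℤ) + (h + 1) = n + 1 + h by ring]
  have up : ∀ k : ℕ, ∑ n ∈ Finset.Icc 1 N, u (n + (k : ℤ)) ≤
      ∑ n ∈ Finset.Icc 1 N, u n + B * k := by
    intro k
    induction k with
    | zero => simp
    | succ k ih =>
      have h1 := step k
      have h2 := hu (1 + k)
      have h3 := huB (N + 1 + k)
      push_cast
      linarith
  have down : ∀ k : ℕ, ∑ n ∈ Finset.Icc 1 N, u (n + (-(k : ℤ))) ≤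
      ∑ n ∈ Finset.Icc 1 N, u n + B * k := by
    intro k
    induction k with
    | zero => simp
    | succ k ih =>
      have h1 := step (-((k : ℤ) + 1))
      have h2 := huB (1 + -((k : ℤ) + 1))
      have h3 := hu (N + 1 + -((k : ℤ) + 1))
      rw [show -((k : ℤ) + 1) + 1 = -k by ring] at h1
      push_cast
      linarith
  rcases Int.eq_nat_or_neg h with ⟨k, rfl | rfl⟩
  · simpa using up k
  · simpa using down k

/-! ### Correlations of MRT functions -/

/-- Conjugation of `z`, performed if the flag is set. -/
def conjIf (b : Bool) (z : ℂ) : ℂ := if b then (starRingEnd ℂ) z else z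

/-- The exponent `-1` if the flag is set (conjugation on the unit circle) and `1` otherwise. -/
def signOf (b : Bool) : ℤ := if b then -1 else 1

lemma norm_conjIf (b : Bool) (z : ℂ) : ‖conjIf b z‖ = ‖z‖ := by cases b <;> simp [conjIf]

lemma conjIf_sub (b : Bool) (z w : ℂ) : conjIf b z - conjIf b w = conjIf b (z - w) := by
  cases b <;> simp [conjIf]

lemma conjIf_exp (b : Bool) (x : ℝ) :
    conjIf b (Complex.exp (x * Complex.I)) =
      Complex.exp (((signOf b * x : ℝ) : ℂ) * Complex.I) := by
  cases b <;> simp [conjIf, signOf, ← Complex.exp_conj]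

lemma prod_conjIf_exp {ι : Type} [Fintype ι] (σ : ι → Bool) (h : ι → ℤ) (S : ℝ) (n : ℕ) :
    ∏ j, conjIf (σ j) (Complex.exp (((S * Real.log (((n : ℤ) + h j : ℤ) : ℝ) : ℝ) : ℂ) *
      Complex.I)) =
    Complex.exp (((S * logPhase (fun j => signOf (σ j)) h n : ℝ) : ℂ) * Complex.I) := by
  simp_rw [conjIf_exp]
  rw [← Complex.exp_sum, ← Finset.sum_mul, ← Complex.ofReal_sum]
  congr 3
  rw [logPhase, Finset.mul_sum]
  refine Finset.sum_congr rfl fun j _ => ?_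
  push_cast
  ring

/-- The growth conditions on the averaging lengths, in the same form for all `d ≥ 0`:
`N m → ∞`, `N m ^ d ≺ s (m + 1) ≺ N m ^ (d + 1)`, and `N m ≤ t (m + 1)` for large `m`. -/
structure AdmissibleGrowth (t s : ℕ → ℤ) (d : ℕ) (N : ℕ → ℕ) : Prop where
  tendsto_N : Tendsto N atTop atTop
  s_pos : ∀ᶠ m in atTop, (0 : ℝ) < s (m + 1)
  low : Tendsto (fun m => (N m : ℝ) ^ d / (s (m + 1) : ℝ)) atTop (𝓝 0)
  upp : Tendsto (fun m => (s (m + 1) : ℝ) / (N m : ℝ) ^ (d + 1)) atTop (𝓝 0)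
  le_t : ∀ᶠ m in atTop, (N m : ℤ) ≤ t (m + 1)

/-- The hypotheses for `d = 0` and `d ≥ 1` both give `AdmissibleGrowth`. For `d ≥ 1`, the bound
`N m ≤ t (m + 1)` follows from `N m ≤ N m ^ d < s (m + 1) ≤ t (m + 1)`. -/
theorem IsMRTWith.admissibleGrowth {f : ℕ+ →* Circle} {t s : ℕ → ℤ} (hf : IsMRTWith f t s)
    {d : ℕ} {N : ℕ → ℕ} (hNpos : ∀ m : ℕ, 1 ≤ m → 0 < N m)
    (hN_zero : d = 0 →
      Prec (fun m => (s (m + 1) : ℝ)) (fun m => (N m : ℝ)) ∧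
        ∀ m : ℕ, 1 ≤ m → (N m : ℤ) ≤ t (m + 1))
    (hN_pos : 0 < d →
      Prec (fun m => (s (m + 1) : ℝ) ^ (1 / ((d : ℝ) + 1))) (fun m => (N m : ℝ)) ∧
        Prec (fun m => (N m : ℝ)) (fun m => (s (m + 1) : ℝ) ^ (1 / (d : ℝ)))) :
    AdmissibleGrowth t s d N := by
  have hs_lt : ∀ m : ℕ, 1 ≤ m → (m : ℝ) < s (m + 1) := fun m hm => by
    exact_mod_cast hf.lt_s_succ hm
  have hs_pos : ∀ᶠ m : ℕ in atTop, (0 : ℝ) < s (m + 1) := by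
    filter_upwards [eventually_ge_atTop 1] with m hm
    exact (Nat.cast_nonneg m).trans_lt (hs_lt m hm)
  have hs : Tendsto (fun m => (s (m + 1) : ℝ)) atTop atTop :=
    tendsto_atTop_mono' _ ((eventually_ge_atTop 1).mono fun m hm => (hs_lt m hm).le)
      tendsto_natCast_atTop_atTop
  have hupp : Tendsto (fun m => (s (m + 1) : ℝ) / (N m : ℝ) ^ (d + 1)) atTop (𝓝 0) := by
    rcases Nat.eq_zero_or_pos d with hd | hd
    · subst hd
      simpa [Prec] using (hN_zero rfl).1
    · have := (hN_pos hd).1.pow (d + 1)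
      rw [zero_pow (Nat.succ_ne_zero d)] at this
      refine this.congr' ?_
      filter_upwards [hs_pos] with m hm
      rw [div_pow, ← Real.rpow_natCast, ← Real.rpow_mul hm.le]
      push_cast
      rw [one_div_mul_cancel (by positivity), Real.rpow_one]
  have hlow : Tendsto (fun m => (N m : ℝ) ^ d / (s (m + 1) : ℝ)) atTop (𝓝 0) := by
    rcases Nat.eq_zero_or_pos d with hd | hd
    · subst hd
      simpa using hs.const_div_atTop 1
    · have := (hN_pos hd).2.pow d
      rw [zero_pow hd.ne'] at this
      refine this.congr' ?_
      filter_upwards [hs_pos] with m hm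
      have hd' : (d : ℝ) ≠ 0 := by exact_mod_cast hd.ne'
      rw [div_pow, ← Real.rpow_natCast (_ ^ (1 / (d : ℝ))), ← Real.rpow_mul hm.le,
        one_div_mul_cancel hd', Real.rpow_one]
  refine ⟨?_, hs_pos, hlow, hupp, ?_⟩
  · refine tendsto_atTop.2 fun b => ?_
    filter_upwards [hupp.eventually_lt_const zero_lt_one, hs.eventually_gt_atTop ((b : ℝ) ^ (d + 1)),
      eventually_ge_atTop 1] with m h1 h2 hm
    have hNm : (0 : ℝ) < N m := by exact_mod_cast hNpos m hm
    rw [div_lt_one (by positivity)] at h1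
    have h3 : (b : ℝ) ^ (d + 1) < (N m : ℝ) ^ (d + 1) := h2.trans h1
    have h4 := lt_of_pow_lt_pow_left₀ (d + 1) hNm.le h3
    exact_mod_cast h4.le
  · rcases Nat.eq_zero_or_pos d with hd | hd
    · filter_upwards [eventually_ge_atTop 1] with m hm
      exact (hN_zero hd).2 m hm
    · filter_upwards [hlow.eventually_lt_const zero_lt_one, hs_pos, eventually_ge_atTop 1]
        with m h1 hsm hm
      rw [div_lt_one hsm] at h1
      have hNm : (1 : ℝ) ≤ N m := by exact_mod_cast hNpos m hm
      have h2 : (N m : ℝ) ≤ s (m + 1) := (le_self_pow₀ hNm hd.ne').trans h1.le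
      have h3 : (N m : ℤ) ≤ s (m + 1) := by exact_mod_cast h2
      obtain ⟨-, h4, h5⟩ := hf.growth m hm
      omega

/-- The means of the correlations of an MRT function converge, to `1` if all moments of order at
most `d` vanish and to `0` otherwise. -/
theorem IsMRTWith.tendsto_cesaro_correlation {f : ℕ+ →* Circle} {t s : ℕ → ℤ}
    (hf : IsMRTWith f t s) {d : ℕ} {N : ℕ → ℕ} (hN : AdmissibleGrowth t s d N) {a : SeqSpace}
    (ha : ∀ n : ℕ+, (a ((n : ℕ) : ℤ) : ℂ) = (f n : ℂ))
    {ι : Type} [Fintype ι] (σ : ι → Bool) (h : ι → ℤ) :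
    Tendsto (fun m => cesaro (N m) (fun n => ∏ j, conjIf (σ j) (a (n + h j)))) atTop
      (𝓝 (open Classical in
        if ∀ i ≤ d, weightedMoment (fun j => signOf (σ j)) h i = 0 then 1 else 0)) := by
  set χ : ℕ → ℤ → ℂ := fun m k =>
    Complex.exp ((((s (m + 1) : ℝ) * Real.log (k : ℝ) : ℝ) : ℂ) * Complex.I) with hχ
  have hχ1 : ∀ m k, ‖χ m k‖ = 1 := fun m k => Complex.norm_exp_ofReal_mul_I _
  have ha1 : ∀ k, ‖(a k : ℂ)‖ ≤ 1 := fun k => mem_closedBall_zero_iff.1 (a k).2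
  have hmain : Tendsto (fun m => cesaro (N m) (fun n => ∏ j, conjIf (σ j) (χ m (n + h j)))) atTop
      (𝓝 (open Classical in
        if ∀ i ≤ d, weightedMoment (fun j => signOf (σ j)) h i = 0 then 1 else 0)) := by
    simp only [hχ, prod_conjIf_exp]
    split_ifs with hm
    · exact tendsto_cesaro_logPhase_one hm hN.tendsto_N hN.s_pos hN.upp
    · push Not at hm
      exact tendsto_cesaro_logPhase_zero hN.tendsto_N hN.s_pos hN.low hN.upp hm
  have herr : Tendsto (fun m : ℕ => ∑ j, (1 / (m : ℝ) + 2 * |(h j : ℝ)| / N m)) atTop (𝓝 0) := by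
    have hNr : Tendsto (fun m => (N m : ℝ)) atTop atTop :=
      tendsto_natCast_atTop_atTop.comp hN.tendsto_N
    rw [show (0 : ℝ) = ∑ j : ι, (0 + 0) by simp]
    exact tendsto_finsetSum _ fun j _ =>
      (tendsto_natCast_atTop_atTop.const_div_atTop _).add (hNr.const_div_atTop _)
  have hdiff : Tendsto (fun m => cesaro (N m) (fun n => ∏ j, conjIf (σ j) (a (n + h j))) -
      cesaro (N m) (fun n => ∏ j, conjIf (σ j) (χ m (n + h j)))) atTop (𝓝 0) := by
    refine squeeze_zero_norm' ?_ herr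
    filter_upwards [hN.le_t, hN.tendsto_N.eventually_gt_atTop 0, eventually_ge_atTop 1]
      with m hle hNm hm
    have hN0 : (0 : ℝ) < N m := by exact_mod_cast hNm
    rw [← cesaro_sub]
    refine (norm_cesaro_le _ _).trans ?_
    rw [div_le_iff₀ hN0]
    calc _ ≤ ∑ n ∈ Finset.Icc 1 (N m), ∑ j, ‖(a (n + h j) : ℂ) - χ m (n + h j)‖ := by
          refine Finset.sum_le_sum fun n _ => ?_
          refine (norm_prod_sub_prod_le_sum _ (fun j => ?_) (fun j => ?_)).trans_eq ?_
          · rw [norm_conjIf]; exact ha1 _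
          · rw [norm_conjIf, hχ1]
          · simp_rw [conjIf_sub, norm_conjIf]
      _ = ∑ j, ∑ n ∈ Finset.Icc 1 (N m), ‖(a (n + h j) : ℂ) - χ m (n + h j)‖ := Finset.sum_comm
      _ ≤ ∑ j, (N m / (t m : ℝ) + 2 * |(h j : ℝ)|) := by
          refine Finset.sum_le_sum fun j _ => ?_
          refine (sum_shift_le (u := fun k => ‖(a k : ℂ) - χ m k‖) (B := 2)
            (fun _ => norm_nonneg _) (fun k => ?_) (N m) (h j)).trans ?_
          · refine (norm_sub_le _ _).trans ?_
            rw [hχ1]; linarith [ha1 k]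
          · gcongr
            simpa [hχ] using hf.sum_norm_sub_exp_le hm hle ha
      _ ≤ ∑ j, (N m / (m : ℝ) + 2 * |(h j : ℝ)|) := by
          have hm0 : (0 : ℝ) < m := by exact_mod_cast hm
          have : (m : ℝ) ≤ t m := by exact_mod_cast hf.le_t hm
          gcongr
      _ = _ := by
          rw [Finset.sum_mul]
          refine Finset.sum_congr rfl fun j _ => ?_
          field_simp
  simpa using hmain.add hdiff

/-! ### Moments and binomial moments -/

/-- Moments against powers and moments against binomial coefficients vanish simultaneously up to
any given order, since the falling factorial polynomials are monic. -/
lemma forall_weightedMoment_eq_zero_iff {ι : Type} [Fintype ι] (ε h : ι → ℤ) (d : ℕ) :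
    (∀ i ≤ d, weightedMoment ε h i = 0) ↔ ∀ i ≤ d, ∑ j, ε j * Ring.choose (h j) i = 0 := by
  have rel : ∀ i : ℕ, (i.factorial : ℤ) * ∑ j, ε j * Ring.choose (h j) i =
      ∑ l ∈ Finset.range i, (descPochhammer ℤ i).coeff l * weightedMoment ε h l +
        weightedMoment ε h i := by
    intro i
    have h1 : ∀ j, (i.factorial : ℤ) * Ring.choose (h j) i =
        ∑ l ∈ Finset.range i, (descPochhammer ℤ i).coeff l * h j ^ l + h j ^ i := by
      intro j
      have h2 := Ring.descPochhammer_eq_factorial_smul_choose (h j) i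
      rw [nsmul_eq_mul] at h2
      rw [← h2, ← Polynomial.eval_eq_smeval, Polynomial.eval_eq_sum_range,
        descPochhammer_natDegree, Finset.sum_range_succ]
      have h3 := (monic_descPochhammer ℤ i).coeff_natDegree
      rw [descPochhammer_natDegree] at h3
      rw [h3, one_mul]
    calc _ = ∑ j, ε j * ((i.factorial : ℤ) * Ring.choose (h j) i) := by
          rw [Finset.mul_sum]; exact Finset.sum_congr rfl fun j _ => by ring
      _ = ∑ j, (∑ l ∈ Finset.range i, (descPochhammer ℤ i).coeff l * (ε j * h j ^ l) +
            ε j * h j ^ i) := by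
          refine Finset.sum_congr rfl fun j _ => ?_
          rw [h1, mul_add, Finset.mul_sum]
          congr 1
          exact Finset.sum_congr rfl fun l _ => by ring
      _ = _ := by
          rw [Finset.sum_add_distrib, Finset.sum_comm]
          simp only [weightedMoment, Finset.mul_sum]
  constructor
  · intro hm i hi
    have := rel i
    have h0 : ∑ l ∈ Finset.range i, (descPochhammer ℤ i).coeff l * weightedMoment ε h l = 0 :=
      Finset.sum_eq_zero fun l hl => by
        rw [hm l (by have := Finset.mem_range.1 hl; omega), mul_zero]
    rw [hm i hi, h0, add_zero] at this
    exact (mul_eq_zero.1 this).resolve_left (by exact_mod_cast i.factorial_ne_zero)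
  · intro hc i
    induction i using Nat.strong_induction_on with
    | _ i ih =>
      intro hi
      have := rel i
      rw [hc i hi, mul_zero, Finset.sum_eq_zero, zero_add] at this
      · exact this.symm
      · intro l hl
        have hl' := Finset.mem_range.1 hl
        rw [ih l hl' (by omega), mul_zero]

/-! ### Haar measure on the torus -/

lemma volume_unitAddCircle :
    (volume : Measure UnitAddCircle) = AddCircle.haarAddCircle := by
  rw [AddCircle.volume_eq_smul_haarAddCircle]; simp

instance isProbabilityMeasure_volume_unitAddCircle :
    IsProbabilityMeasure (volume : Measure UnitAddCircle) := by
  rw [volume_unitAddCircle]; infer_instance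

instance isProbabilityMeasure_volume_torus (d : ℕ) :
    IsProbabilityMeasure (volume : Measure (Fin d → UnitAddCircle)) :=
  inferInstanceAs (IsProbabilityMeasure (Measure.pi fun _ => volume))

lemma volume_torus (d : ℕ) : (volume : Measure (Fin d → UnitAddCircle)) =
    Measure.pi fun _ => AddCircle.haarAddCircle := by
  rw [volume_pi, volume_unitAddCircle]

lemma integral_fourier (k : ℤ) :
    ∫ x : UnitAddCircle, (fourier k x : ℂ) = if k = 0 then 1 else 0 := by
  split_ifs with hk
  · subst hk; simp
  · have h1 := integral_add_right_eq_self (μ := (volume : Measure UnitAddCircle))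
      (fun x => (fourier k x : ℂ)) (((1 : ℝ) / 2 / k : ℝ) : UnitAddCircle)
    simp_rw [fourier_add_half_inv_index hk one_pos, integral_neg] at h1
    exact self_eq_neg.1 h1.symm

lemma integral_mFourier {d : ℕ} (n : Fin d → ℤ) :
    ∫ x : Fin d → UnitAddCircle, UnitAddTorus.mFourier n x = if n = 0 then 1 else 0 := by
  have : ∀ x : Fin d → UnitAddCircle,
      UnitAddTorus.mFourier n x = ∏ i, (fourier (n i) (x i) : ℂ) := fun _ => rfl
  simp_rw [this]
  rw [integral_fintype_prod_volume_eq_prod (fun i => fun y : UnitAddCircle =>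
    (fourier (n i) y : ℂ))]
  simp_rw [integral_fourier]
  rw [Finset.prod_ite_zero]
  simp [funext_iff]

/-! ### The unipotent transformation and its orbit coding -/

lemma unipotentMap_zero (d : ℕ) (x : Fin (d + 1) → UnitAddCircle) : unipotentMap d x 0 = x 0 := rfl

lemma unipotentMap_succ (d : ℕ) (x : Fin (d + 1) → UnitAddCircle) (i : Fin d) :
    unipotentMap d x i.succ = x i.succ + x i.castSucc := rfl

/-- The unipotent transformation as a group endomorphism of the torus. -/
def unipotentHom (d : ℕ) : (Fin (d + 1) → UnitAddCircle) →+ (Fin (d + 1) → UnitAddCircle) where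
  toFun := unipotentMap d
  map_zero' := by
    funext i
    refine Fin.cases ?_ (fun i => ?_) i
    · rfl
    · rw [unipotentMap_succ]; simp
  map_add' x y := by
    funext i
    refine Fin.cases ?_ (fun i => ?_) i
    · rfl
    · simp only [Pi.add_apply, unipotentMap_succ]; abel

lemma continuous_unipotentMap (d : ℕ) : Continuous (unipotentMap d) := by
  refine continuous_pi fun i => ?_
  refine Fin.cases ?_ (fun i => ?_) i
  · exact continuous_apply 0
  · exact (continuous_apply _).add (continuous_apply _)

lemma surjective_unipotentMap (d : ℕ) : Function.Surjective (unipotentMap d) := by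
  intro y
  refine ⟨fun i => Fin.induction (motive := fun _ => UnitAddCircle) (y 0)
    (fun i z => y i.succ - z) i, ?_⟩
  funext i
  refine Fin.cases rfl (fun i => ?_) i
  rw [unipotentMap_succ, Fin.induction_succ, sub_add_cancel]

theorem measurePreserving_unipotentMap (d : ℕ) :
    MeasurePreserving (unipotentMap d) volume volume :=
  AddMonoidHom.measurePreserving (f := unipotentHom d) (continuous_unipotentMap d)
    (surjective_unipotentMap d) rfl

/-- The last coordinate of the `k`-th iterate of the unipotent transformation at `x`, for any
integer `k`. -/
def unipotentCoord (d : ℕ) (k : ℤ) (x : Fin (d + 1) → UnitAddCircle) : UnitAddCircle :=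
  ∑ i : Fin (d + 1), Ring.choose k (d - i : ℕ) • x i

lemma unipotentCoord_unipotentMap (d : ℕ) (k : ℤ) (x : Fin (d + 1) → UnitAddCircle) :
    unipotentCoord d k (unipotentMap d x) = unipotentCoord d (k + 1) x := by
  have hL : unipotentCoord d k (unipotentMap d x) = unipotentCoord d k x +
      ∑ i : Fin d, Ring.choose k (d - (i + 1) : ℕ) • x i.castSucc := by
    rw [unipotentCoord, unipotentCoord, Fin.sum_univ_succ, Fin.sum_univ_succ, unipotentMap_zero,
      add_assoc, ← Finset.sum_add_distrib]
    simp only [unipotentMap_succ, smul_add, Fin.val_succ]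
  have hR : unipotentCoord d (k + 1) x = unipotentCoord d k x +
      ∑ i : Fin d, Ring.choose k (d - (i + 1) : ℕ) • x i.castSucc := by
    rw [unipotentCoord, unipotentCoord, Fin.sum_univ_castSucc, Fin.sum_univ_castSucc,
      add_right_comm, ← Finset.sum_add_distrib]
    congr 1
    · refine Finset.sum_congr rfl fun i _ => ?_
      have hi : d - (i.castSucc : ℕ) = (d - (i + 1)) + 1 := by
        have := i.2; simp only [Fin.val_castSucc]; omega
      rw [hi, Ring.choose_succ_succ, add_smul, add_comm]
    · simp
  rw [hL, hR]

lemma continuous_unipotentCoord (d : ℕ) (k : ℤ) : Continuous (unipotentCoord d k) :=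
  continuous_finsetSum _ fun i _ => (continuous_apply i).zsmul _

/-- The coordinates `0, …, d` of an orbit determine its base point, by triangularity of Pascal's
matrix. -/
lemma eq_of_unipotentCoord_eq {d : ℕ} {x y : Fin (d + 1) → UnitAddCircle}
    (h : ∀ k, unipotentCoord d k x = unipotentCoord d k y) : x = y := by
  have key : ∀ k : ℕ, ∀ i : Fin (d + 1), d - (i : ℕ) = k → x i = y i := by
    intro k
    induction k using Nat.strong_induction_on with
    | _ k ih =>
      intro i hi
      have h1 := h k
      rw [unipotentCoord, unipotentCoord, ← sub_eq_zero, ← Finset.sum_sub_distrib,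
        Finset.sum_eq_single i] at h1
      · rw [hi, Ring.choose_natCast, Nat.choose_self, Nat.cast_one, one_smul, one_smul] at h1
        exact sub_eq_zero.1 h1
      · intro j _ hji
        rw [Ring.choose_natCast]
        rcases lt_trichotomy (d - (j : ℕ)) k with hlt | heq | hgt
        · rw [ih _ hlt j rfl, sub_self]
        · exact absurd (Fin.ext (by have := i.2; have := j.2; omega)) hji
        · rw [Nat.choose_eq_zero_of_lt hgt]; simp
      · exact fun hni => absurd (Finset.mem_univ i) hni
  funext i
  exact key _ i rfl

/-- The coding of a point of the torus by the sequence `e((S ^ k x)_d)`, `k ∈ ℤ`, of the values of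
the last character along its orbit under the unipotent transformation. -/
def orbitSeq (d : ℕ) (x : Fin (d + 1) → UnitAddCircle) : SeqSpace := fun k =>
  ⟨((unipotentCoord d k x).toCircle : ℂ),
    mem_closedBall_zero_iff.2 (Circle.norm_coe _).le⟩

lemma orbitSeq_apply (d : ℕ) (x : Fin (d + 1) → UnitAddCircle) (k : ℤ) :
    (orbitSeq d x k : ℂ) = (unipotentCoord d k x).toCircle := rfl

lemma shift_orbitSeq (d : ℕ) (x : Fin (d + 1) → UnitAddCircle) :
    shift (orbitSeq d x) = orbitSeq d (unipotentMap d x) := by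
  funext k
  apply Subtype.ext
  rw [orbitSeq_apply, unipotentCoord_unipotentMap]
  rfl

lemma continuous_orbitSeq (d : ℕ) : Continuous (orbitSeq d) :=
  continuous_pi fun k => Continuous.subtype_mk (continuous_subtype_val.comp
    (AddCircle.continuous_toCircle.comp (continuous_unipotentCoord d k))) _

lemma injective_orbitSeq (d : ℕ) : Function.Injective (orbitSeq d) := by
  intro x y hxy
  refine eq_of_unipotentCoord_eq fun k => ?_
  have := congrArg (fun z : SeqSpace => (z k : ℂ)) hxy
  exact AddCircle.injective_toCircle one_ne_zero (Circle.coe_injective this)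

lemma measurableEmbedding_orbitSeq (d : ℕ) : MeasurableEmbedding (orbitSeq d) :=
  ((continuous_orbitSeq d).isClosedEmbedding (injective_orbitSeq d)).measurableEmbedding

/-- The law of the coded orbit of a uniformly distributed point of the torus. -/
def orbitMeasure (d : ℕ) : Measure SeqSpace := Measure.map (orbitSeq d) volume

instance isProbabilityMeasure_orbitMeasure (d : ℕ) : IsProbabilityMeasure (orbitMeasure d) :=
  Measure.isProbabilityMeasure_map (measurableEmbedding_orbitSeq d).measurable.aemeasurable

lemma measurePreserving_orbitSeq (d : ℕ) :
    MeasurePreserving (orbitSeq d) volume (orbitMeasure d) :=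
  ⟨(measurableEmbedding_orbitSeq d).measurable, rfl⟩

lemma conjIf_toCircle (b : Bool) (y : UnitAddCircle) :
    conjIf b (y.toCircle : ℂ) = ((signOf b • y).toCircle : ℂ) := by
  cases b
  · simp [conjIf, signOf]
  · simp [conjIf, signOf, AddCircle.toCircle_neg, ← Circle.coe_inv_eq_conj]

/-- The coded orbit has the same correlations as the MRT function. -/
lemma integral_correlation_orbitMeasure (d : ℕ) {ι : Type} [Fintype ι] (σ : ι → Bool)
    (h : ι → ℤ) :
    ∫ y, ∏ j, conjIf (σ j) (y (h j)) ∂(orbitMeasure d) =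
      open Classical in
        if ∀ i ≤ d, weightedMoment (fun j => signOf (σ j)) h i = 0 then 1 else 0 := by
  rw [orbitMeasure, (measurableEmbedding_orbitSeq d).integral_map]
  set n : Fin (d + 1) → ℤ := fun i => ∑ j, signOf (σ j) * Ring.choose (h j) (d - i : ℕ) with hn
  have hchar : ∀ x : Fin (d + 1) → UnitAddCircle,
      ∏ j, conjIf (σ j) (orbitSeq d x (h j)) = UnitAddTorus.mFourier n x := by
    intro x
    simp_rw [orbitSeq_apply, conjIf_toCircle, unipotentCoord, Finset.smul_sum, smul_smul]
    change _ = ∏ i, (fourier (n i) (x i) : ℂ)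
    have hsum : ∀ (κ : Type) [Fintype κ] (v : κ → UnitAddCircle),
        ((∑ i, v i).toCircle : ℂ) = ∏ i, ((v i).toCircle : ℂ) := by
      intro κ _ v
      classical
      have : ∀ I : Finset κ, ((∑ i ∈ I, v i).toCircle : ℂ) = ∏ i ∈ I, ((v i).toCircle : ℂ) := by
        intro I
        induction I using Finset.induction_on with
        | empty => simp
        | insert i I hi ih =>
          rw [Finset.sum_insert hi, Finset.prod_insert hi, AddCircle.toCircle_add,
            Circle.coe_mul, ih]
      exact this _
    simp_rw [fourier_apply, hn, Finset.sum_smul, hsum]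
    exact Finset.prod_comm
  simp_rw [hchar, integral_mFourier, forall_weightedMoment_eq_zero_iff]
  have : n = 0 ↔ ∀ i ≤ d, ∑ j, signOf (σ j) * Ring.choose (h j) i = 0 := by
    constructor
    · intro h0 i hi
      have := congrFun h0 ⟨d - i, by omega⟩
      simpa [hn, Nat.sub_sub_self hi] using this
    · intro h0
      funext i
      exact h0 _ (Nat.sub_le _ _)
  simp_rw [this]

/-! ### Eigenfunctions of the unipotent transformation -/

/-- The dual of the unipotent transformation, acting on the frequencies of characters by
`n ↦ (n₀ + n₁, …, n_{d-1} + n_d, n_d)`. -/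
def dualUnipotent (d : ℕ) (n : Fin (d + 1) → ℤ) : Fin (d + 1) → ℤ := fun i =>
  n i + if h : (i : ℕ) + 1 < d + 1 then n ⟨i + 1, h⟩ else 0

lemma mFourier_unipotentMap (d : ℕ) (n : Fin (d + 1) → ℤ) (x : Fin (d + 1) → UnitAddCircle) :
    UnitAddTorus.mFourier n (unipotentMap d x) = UnitAddTorus.mFourier (dualUnipotent d n) x := by
  change ∏ i, (fourier (n i) (unipotentMap d x i) : ℂ) =
    ∏ i, (fourier (dualUnipotent d n i) (x i) : ℂ)
  simp_rw [dualUnipotent, fourier_add, Finset.prod_mul_distrib]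
  have h1 : ∏ i : Fin (d + 1),
      (fourier (if h : (i : ℕ) + 1 < d + 1 then n ⟨i + 1, h⟩ else 0) (x i) : ℂ) =
      ∏ i : Fin d, (fourier (n i.succ) (x i.castSucc) : ℂ) := by
    rw [Fin.prod_univ_castSucc]
    simp only [Fin.val_castSucc, Fin.val_last, lt_irrefl, dite_false, fourier_zero, mul_one]
    refine Finset.prod_congr rfl fun i _ => ?_
    rw [dif_pos (by omega)]
    rfl
  have h2 : ∀ (k : ℤ) (y z : UnitAddCircle),
      (fourier k (y + z) : ℂ) = fourier k y * fourier k z := by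
    intro k y z
    simp only [fourier_apply, smul_add, AddCircle.toCircle_add, Circle.coe_mul]
  rw [h1, Fin.prod_univ_succ, Fin.prod_univ_succ, unipotentMap_zero, mul_assoc,
    ← Finset.prod_mul_distrib]
  simp_rw [unipotentMap_succ, h2]

/-- The orbit of a frequency under the dual map is infinite unless it is a fixed point. -/
lemma injective_iterate_dualUnipotent {d : ℕ} {n : Fin (d + 1) → ℤ} (hn : dualUnipotent d n ≠ n) :
    Function.Injective fun k : ℕ => (dualUnipotent d)^[k] n := by
  -- `i` is the largest index with `n i ≠ 0`; coordinate `i - 1` then grows linearly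
  have hex : ∃ i : Fin (d + 1), (i : ℕ) ≠ 0 ∧ n i ≠ 0 := by
    by_contra! hcon
    refine hn (funext fun i => ?_)
    simp only [dualUnipotent]
    split_ifs with h
    · rw [hcon ⟨i + 1, h⟩ (Nat.succ_ne_zero _), add_zero]
    · rw [add_zero]
  obtain ⟨i, hi, hmax⟩ := Finset.exists_max_image
    (Finset.univ.filter fun i : Fin (d + 1) => (i : ℕ) ≠ 0 ∧ n i ≠ 0) id
    (by obtain ⟨i, hi⟩ := hex; exact ⟨i, by simpa using hi⟩)
  obtain ⟨hi0, hni⟩ := (Finset.mem_filter.1 hi).2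
  have hzero : ∀ j, i < j → n j = 0 := by
    intro j hj
    by_contra hnj
    have hj0 : (j : ℕ) ≠ 0 := by have : (i : ℕ) < j := hj; omega
    exact absurd (hmax j (Finset.mem_filter.2 ⟨Finset.mem_univ j, hj0, hnj⟩)) (not_le.2 hj)
  have hlt : (i : ℕ) - 1 < d + 1 := by omega
  have inv : ∀ k : ℕ, (∀ j, i < j → (dualUnipotent d)^[k] n j = 0) ∧
      (dualUnipotent d)^[k] n i = n i ∧
      (dualUnipotent d)^[k] n ⟨i - 1, hlt⟩ = n ⟨i - 1, hlt⟩ + k * n i := by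
    intro k
    induction k with
    | zero => exact ⟨hzero, rfl, by simp⟩
    | succ k ih =>
      obtain ⟨h1, h2, h3⟩ := ih
      rw [Function.iterate_succ_apply']
      have hnext : ∀ j : Fin (d + 1), i ≤ j →
          (if h : (j : ℕ) + 1 < d + 1 then (dualUnipotent d)^[k] n ⟨j + 1, h⟩ else 0) = 0 := by
        intro j hj
        split_ifs with h
        · exact h1 _ (Fin.lt_def.2 (by have := Fin.le_def.1 hj; simp only; omega))
        · rfl
      refine ⟨fun j hj => ?_, ?_, ?_⟩
      · rw [dualUnipotent, hnext j hj.le, h1 j hj, add_zero]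
      · rw [dualUnipotent, hnext i le_rfl, h2, add_zero]
      · have hidx : ∀ h : ((⟨i - 1, hlt⟩ : Fin (d + 1)) : ℕ) + 1 < d + 1,
            (⟨((⟨i - 1, hlt⟩ : Fin (d + 1)) : ℕ) + 1, h⟩ : Fin (d + 1)) = i :=
          fun h => Fin.ext (by simp only; omega)
        rw [dualUnipotent, dif_pos (by simp only; omega), hidx, h2, h3]
        push_cast
        ring
  intro k l hkl
  have h := congrFun hkl ⟨i - 1, hlt⟩
  simp only [(inv _).2.2] at h
  have := mul_right_cancel₀ hni (add_left_cancel h)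
  exact_mod_cast this

/-- The unipotent transformation has no eigenvalue on the unit circle other than `1`: the Fourier
coefficients of an eigenfunction have constant modulus along the orbits of the dual map, hence
vanish along the infinite ones, and the remaining characters are invariant. -/
theorem ae_eq_zero_of_comp_unipotentMap {d : ℕ} {g : (Fin (d + 1) → UnitAddCircle) → ℂ}
    (hg : MemLp g 2 volume) {c : ℂ} (hc : ‖c‖ = 1) (hc1 : c ≠ 1)
    (hgc : ∀ᵐ x ∂volume, g (unipotentMap d x) = c * g x) : g =ᵐ[volume] 0 := by
  set coef : (Fin (d + 1) → ℤ) → ℂ := fun n =>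
    ∫ x : Fin (d + 1) → UnitAddCircle, UnitAddTorus.mFourier (-n) x * g x with hcoef
  have hparseval : HasSum (fun n => ‖coef n‖ ^ 2)
      (∫ x : Fin (d + 1) → UnitAddCircle, ‖g x‖ ^ 2) := by
    have hg' : MemLp g 2 (Measure.pi fun _ => AddCircle.haarAddCircle) := by
      rwa [← volume_torus]
    have h := UnitAddTorus.hasSum_sq_mFourierCoeff (hg'.toLp g)
    have h1 : ∀ n, UnitAddTorus.mFourierCoeff (hg'.toLp g) n = coef n := by
      intro n
      rw [hcoef]
      simp only
      rw [volume_torus]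
      refine integral_congr_ae ?_
      filter_upwards [hg'.coeFn_toLp] with x hx
      rw [hx, smul_eq_mul]
    simp_rw [h1] at h
    convert h using 1
    rw [volume_torus]
    refine integral_congr_ae ?_
    filter_upwards [hg'.coeFn_toLp] with x hx
    rw [hx]
  have hrec : ∀ n, coef n = c * coef (dualUnipotent d n) := by
    intro n
    have hS := measurePreserving_unipotentMap d
    have hneg : -dualUnipotent d n = dualUnipotent d (-n) := by
      funext i
      simp only [dualUnipotent, Pi.neg_apply, neg_add]
      split_ifs <;> simp
    have hmeas : AEStronglyMeasurable (fun x => UnitAddTorus.mFourier (-n) x * g x)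
        (Measure.map (unipotentMap d) volume) := by
      rw [hS.map_eq]
      exact (UnitAddTorus.mFourier (-n)).continuous.aestronglyMeasurable.mul
        hg.aestronglyMeasurable
    have h1 := integral_map hS.measurable.aemeasurable hmeas
    rw [hS.map_eq] at h1
    calc coef n = _ := h1
      _ = ∫ x : Fin (d + 1) → UnitAddCircle,
            c * (UnitAddTorus.mFourier (-dualUnipotent d n) x * g x) := by
          refine integral_congr_ae ?_
          filter_upwards [hgc] with x hx
          rw [hx, mFourier_unipotentMap, hneg]
          ring
      _ = _ := integral_const_mul _ _
  have hzero : ∀ n, coef n = 0 := by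
    intro n
    by_cases hn : dualUnipotent d n = n
    · have h := hrec n
      rw [hn] at h
      have h2 : (1 - c) * coef n = 0 := by linear_combination h
      exact (mul_eq_zero.1 h2).resolve_left (sub_ne_zero.2 hc1.symm)
    · have hconst : ∀ k : ℕ, ‖coef ((dualUnipotent d)^[k] n)‖ = ‖coef n‖ := by
        intro k
        induction k with
        | zero => rfl
        | succ k ih =>
          rw [← ih, hrec ((dualUnipotent d)^[k] n), norm_mul, hc, one_mul,
            Function.iterate_succ_apply']
      have hsum := hparseval.summable.comp_injective (injective_iterate_dualUnipotent hn)
      have hlim := hsum.tendsto_atTop_zero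
      simp only [Function.comp_def, hconst] at hlim
      have := tendsto_nhds_unique tendsto_const_nhds hlim
      simpa using this
  have hint : ∫ x : Fin (d + 1) → UnitAddCircle, ‖g x‖ ^ 2 = 0 := by
    refine hparseval.unique ?_
    simp [hzero]
  rw [integral_eq_zero_iff_of_nonneg (fun x => by positivity) hg.integrable_norm_pow'] at hint
  filter_upwards [hint] with x hx
  simpa using hx

/-! ### Weak-star convergence -/

/-- The monomial `∏ⱼ x(hⱼ)` in the coordinates, with conjugations as prescribed by `σ`. -/
def coordMonomial {ι : Type} [Fintype ι] (σ : ι → Bool) (h : ι → ℤ) : C(SeqSpace, ℂ) where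
  toFun y := ∏ j, conjIf (σ j) (y (h j))
  continuous_toFun := by
    refine continuous_finsetProd _ fun j _ => ?_
    have h1 : Continuous fun y : SeqSpace => (y (h j) : ℂ) :=
      continuous_subtype_val.comp (continuous_apply _)
    cases σ j
    · simpa [conjIf] using h1
    · simpa [conjIf, Function.comp_def] using Complex.continuous_conj.comp h1

lemma coordMonomial_apply {ι : Type} [Fintype ι] (σ : ι → Bool) (h : ι → ℤ) (y : SeqSpace) :
    coordMonomial σ h y = ∏ j, conjIf (σ j) (y (h j)) := rfl

/-- By the Stone–Weierstrass theorem, a closed linear condition that holds for all monomials in the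
coordinates holds for all continuous functions. -/
theorem mem_of_forall_coordMonomial_mem (V : Submodule ℂ C(SeqSpace, ℂ))
    (hV : IsClosed (V : Set C(SeqSpace, ℂ)))
    (hmon : ∀ (l : ℕ) (σ : Fin l → Bool) (h : Fin l → ℤ), coordMonomial σ h ∈ V)
    (F : C(SeqSpace, ℂ)) : F ∈ V := by
  set G : Set C(SeqSpace, ℂ) := Set.range fun k : ℤ =>
    coordMonomial (fun _ : Fin 1 => false) (fun _ => k) with hG
  have hdense : (StarAlgebra.adjoin ℂ G).topologicalClosure = ⊤ := by
    refine ContinuousMap.starSubalgebra_topologicalClosure_eq_top_of_separatesPoints _ ?_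
    intro x y hxy
    obtain ⟨k, hk⟩ := Function.ne_iff.1 hxy
    refine ⟨_, ⟨_, StarAlgebra.subset_adjoin ℂ G ⟨k, rfl⟩, rfl⟩, ?_⟩
    simpa [coordMonomial_apply, conjIf, Subtype.ext_iff] using hk
  have hsub : ((StarAlgebra.adjoin ℂ G : StarSubalgebra ℂ C(SeqSpace, ℂ)) :
      Set C(SeqSpace, ℂ)) ⊆ V := by
    intro P hP
    have hP' : P ∈ Subalgebra.toSubmodule (StarAlgebra.adjoin ℂ G).toSubalgebra := hP
    rw [StarAlgebra.adjoin_toSubalgebra, Algebra.adjoin_eq_span] at hP'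
    refine Submodule.span_le.2 ?_ hP'
    intro Q hQ
    have hform : ∃ (l : ℕ) (σ : Fin l → Bool) (h : Fin l → ℤ), Q = coordMonomial σ h := by
      refine Submonoid.closure_induction (motive := fun Q _ =>
        ∃ (l : ℕ) (σ : Fin l → Bool) (h : Fin l → ℤ), Q = coordMonomial σ h) ?_ ?_ ?_ hQ
      · rintro Q (⟨k, rfl⟩ | hQ)
        · exact ⟨1, _, _, rfl⟩
        · obtain ⟨k, hk⟩ := hQ
          refine ⟨1, fun _ => true, fun _ => k, ?_⟩
          rw [← star_star Q, ← hk]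
          ext y
          simp [coordMonomial_apply, conjIf]
      · exact ⟨0, fun _ => false, fun _ => 0, by ext y; simp [coordMonomial_apply]⟩
      · rintro _ _ _ _ ⟨l, σ, h, rfl⟩ ⟨l', σ', h', rfl⟩
        refine ⟨l + l', Fin.append σ σ', Fin.append h h', ?_⟩
        ext y
        simp [coordMonomial_apply, Fin.prod_univ_add]
    obtain ⟨l, σ, h, rfl⟩ := hform
    exact hmon l σ h
  have hF : F ∈ (StarAlgebra.adjoin ℂ G).topologicalClosure := by rw [hdense]; trivial
  exact closure_minimal hsub hV hF

lemma integrable_continuousMap (μ : Measure SeqSpace) [IsFiniteMeasure μ] (F : C(SeqSpace, ℂ)) :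
    Integrable (fun x => F x) μ :=
  Integrable.of_bound F.continuous.aestronglyMeasurable ‖F‖
    (Eventually.of_forall fun x => F.norm_coe_le_norm x)

lemma norm_cesaro_continuousMap_le (a : SeqSpace) (N : ℕ) (F : C(SeqSpace, ℂ)) :
    ‖cesaro N (fun n => F ((shift ^ n) a))‖ ≤ ‖F‖ := by
  refine (norm_cesaro_le _ _).trans ?_
  rcases Nat.eq_zero_or_pos N with rfl | hN
  · simp
  rw [div_le_iff₀ (by exact_mod_cast hN)]
  refine (Finset.sum_le_sum fun n _ => F.norm_coe_le_norm _).trans ?_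
  simp [mul_comm]

/-- Convergence of the empirical averages of all monomials in the coordinates implies weak-star
convergence of the empirical measures. -/
theorem isFurstenbergMeasure_of_coordMonomial {a : SeqSpace} {N : ℕ → ℕ} (μ : Measure SeqSpace)
    [IsProbabilityMeasure μ]
    (hmon : ∀ (l : ℕ) (σ : Fin l → Bool) (h : Fin l → ℤ),
      Tendsto (fun m => cesaro (N m) (fun n => coordMonomial σ h ((shift ^ n) a))) atTop
        (𝓝 (∫ x, coordMonomial σ h x ∂μ))) :
    IsFurstenbergMeasure a N μ := by
  refine ⟨inferInstance, fun F => ?_⟩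
  let E : C(SeqSpace, ℂ) → ℕ → ℂ := fun F m =>
    cesaro (N m) (fun n => F ((shift ^ n) a)) - ∫ x, F x ∂μ
  have hEbound : ∀ F m, ‖E F m‖ ≤ 2 * ‖F‖ := by
    intro F m
    refine (norm_sub_le _ _).trans ?_
    rw [two_mul]
    refine add_le_add (norm_cesaro_continuousMap_le a _ F) ?_
    refine (norm_integral_le_of_norm_le_const
      (Eventually.of_forall fun x => F.norm_coe_le_norm x)).trans ?_
    simp
  have hEadd : ∀ F G m, E (F + G) m = E F m + E G m := by
    intro F G m
    simp only [E, ContinuousMap.add_apply]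
    rw [integral_add (integrable_continuousMap μ F) (integrable_continuousMap μ G)]
    simp only [cesaro, Finset.sum_add_distrib, mul_add]
    ring
  have hEsmul : ∀ (c : ℂ) F m, E (c • F) m = c * E F m := by
    intro c F m
    simp only [E, ContinuousMap.smul_apply, smul_eq_mul]
    rw [integral_const_mul]
    simp only [cesaro, ← Finset.mul_sum]
    ring
  let V : Submodule ℂ C(SeqSpace, ℂ) :=
    { carrier := {F | Tendsto (E F) atTop (𝓝 0)}
      zero_mem' := by
        have : E 0 = fun _ => 0 := by funext m; simp [E, cesaro]
        change Tendsto (E 0) atTop (𝓝 0)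
        rw [this]
        exact tendsto_const_nhds
      add_mem' := fun {F G} hF hG => by
        have : E (F + G) = fun m => E F m + E G m := funext fun m => hEadd F G m
        change Tendsto (E (F + G)) atTop (𝓝 0)
        rw [this]
        simpa using Tendsto.add hF hG
      smul_mem' := fun c F hF => by
        have : E (c • F) = fun m => c * E F m := funext fun m => hEsmul c F m
        change Tendsto (E (c • F)) atTop (𝓝 0)
        rw [this]
        simpa using Tendsto.const_mul c hF }
  have hV : IsClosed (V : Set C(SeqSpace, ℂ)) := by
    refine isClosed_of_closure_subset fun F hF => ?_
    change Tendsto (E F) atTop (𝓝 0)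
    rw [Metric.tendsto_nhds]
    intro ε hε
    obtain ⟨G, hG, hFG⟩ := Metric.mem_closure_iff.1 hF (ε / 4) (by positivity)
    have hG' : Tendsto (E G) atTop (𝓝 0) := hG
    filter_upwards [(Metric.tendsto_nhds.1 hG') (ε / 2) (by positivity)] with m hm
    rw [dist_zero_right] at hm ⊢
    have hsplit : E F m = E (F - G) m + E G m := by rw [← hEadd, sub_add_cancel]
    rw [dist_eq_norm] at hFG
    calc ‖E F m‖ ≤ ‖E (F - G) m‖ + ‖E G m‖ := by rw [hsplit]; exact norm_add_le _ _
      _ < 2 * (ε / 4) + ε / 2 :=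
          add_lt_add ((hEbound _ m).trans_lt (by linarith)) hm
      _ = ε := by ring
  have hF : Tendsto (E F) atTop (𝓝 0) := mem_of_forall_coordMonomial_mem V hV
    (fun l σ h => by
      have := (hmon l σ h).sub_const (∫ x, coordMonomial σ h x ∂μ)
      rwa [sub_self] at this) F
  have := hF.add_const (∫ x, F x ∂μ)
  simpa [E, cesaro] using this

/-- A Furstenberg measure is unique. -/
theorem IsFurstenbergMeasure.unique {a : SeqSpace} {N : ℕ → ℕ} {μ ν : Measure SeqSpace}
    (hμ : IsFurstenbergMeasure a N μ) (hν : IsFurstenbergMeasure a N ν) : μ = ν := by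
  have := hμ.isProbabilityMeasure
  have := hν.isProbabilityMeasure
  refine ext_of_forall_integral_eq_of_IsFiniteMeasure fun F => ?_
  let G : C(SeqSpace, ℂ) := ⟨fun x => (F x : ℂ), Complex.continuous_ofReal.comp F.continuous⟩
  have h := tendsto_nhds_unique (hμ.tendsto G) (hν.tendsto G)
  have hG : ∀ ρ : Measure SeqSpace, ∫ x, G x ∂ρ = ((∫ x, F x ∂ρ : ℝ) : ℂ) :=
    fun ρ => integral_ofReal
  rw [hG, hG] at h
  exact_mod_cast h

/-! ### The system of the coded orbits -/

lemma shift_pow_apply (n : ℕ) (a : SeqSpace) (k : ℤ) : (shift ^ n) a k = a (n + k) := by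
  induction n generalizing k with
  | zero => simp
  | succ n ih =>
    rw [pow_succ', Equiv.Perm.mul_apply]
    change (shift ^ n) a (k + 1) = _
    rw [ih]
    congr 1
    push_cast
    ring

lemma shift_zpow_apply (n : ℤ) (a : SeqSpace) (k : ℤ) : (shift ^ n) a k = a (n + k) := by
  rcases Int.eq_nat_or_neg n with ⟨n, rfl | rfl⟩
  · rw [zpow_natCast, shift_pow_apply]
  · have h := shift_pow_apply n ((shift ^ (-(n : ℤ))) a) (-n + k)
    rw [add_neg_cancel_left] at h
    rw [← h, ← Equiv.Perm.mul_apply, zpow_neg, zpow_natCast, mul_inv_cancel, Equiv.Perm.one_apply]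

theorem IsMRTWith.isFurstenbergMeasure_orbitMeasure {f : ℕ+ →* Circle} {t s : ℕ → ℤ}
    (hf : IsMRTWith f t s) {d : ℕ} {N : ℕ → ℕ} (hN : AdmissibleGrowth t s d N) {a : SeqSpace}
    (ha : ∀ n : ℕ+, (a ((n : ℕ) : ℤ) : ℂ) = (f n : ℂ)) :
    IsFurstenbergMeasure a N (orbitMeasure d) := by
  refine isFurstenbergMeasure_of_coordMonomial _ fun l σ h => ?_
  simp only [coordMonomial_apply, shift_pow_apply]
  rw [integral_correlation_orbitMeasure]
  exact hf.tendsto_cesaro_correlation hN ha σ h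

lemma measurable_shift : Measurable shift :=
  measurable_pi_lambda _ fun k => measurable_pi_apply (k + 1)

lemma measurePreserving_shift_orbitMeasure (d : ℕ) :
    MeasurePreserving shift (orbitMeasure d) (orbitMeasure d) := by
  refine ⟨measurable_shift, ?_⟩
  have hm := (measurableEmbedding_orbitSeq d).measurable
  have hS := measurePreserving_unipotentMap d
  rw [orbitMeasure, Measure.map_map measurable_shift hm]
  have : shift ∘ orbitSeq d = orbitSeq d ∘ unipotentMap d := funext fun x => shift_orbitSeq d x
  rw [this, ← Measure.map_map hm hS.measurable, hS.map_eq]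

lemma systemSpectrum_orbitMeasure (d : ℕ) : systemSpectrum (orbitMeasure d) shift = {0} := by
  refine Set.Subset.antisymm ?_ ?_
  · rintro α ⟨⟨hα0, hα1⟩, g, hg, hne, hgα⟩
    by_contra hα
    have hα' : α ≠ 0 := hα
    have hΨ := measurePreserving_orbitSeq d
    refine hne ?_
    set c : ℂ := Complex.exp (2 * Real.pi * Complex.I * α) with hc
    have hcn : ‖c‖ = 1 := by
      rw [hc, show 2 * (Real.pi : ℂ) * Complex.I * α = ((2 * Real.pi * α : ℝ) : ℂ) * Complex.I by
        push_cast; ring, Complex.norm_exp_ofReal_mul_I]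
    have hc1 : c ≠ 1 := by
      intro h1
      obtain ⟨n, hn⟩ := Complex.exp_eq_one_iff.1 h1
      have h2 : (α : ℂ) = n := by
        have hpi : (2 * Real.pi * Complex.I : ℂ) ≠ 0 := Complex.two_pi_I_ne_zero
        refine mul_left_cancel₀ hpi ?_
        rw [hn]; ring
      have h3 : α = n := by exact_mod_cast h2
      have h4 : (0 : ℤ) < n := by
        have : 0 < α := lt_of_le_of_ne hα0 (Ne.symm hα')
        rw [h3] at this; exact_mod_cast this
      have h5 : n < (1 : ℤ) := by rw [h3] at hα1; exact_mod_cast hα1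
      omega
    have hzero : g ∘ orbitSeq d =ᵐ[volume] 0 := by
      refine ae_eq_zero_of_comp_unipotentMap (hg.comp_measurePreserving hΨ) hcn hc1 ?_
      filter_upwards [hΨ.quasiMeasurePreserving.ae hgα] with x hx
      simpa only [Function.comp_apply, ← shift_orbitSeq] using hx
    have hme := measurableEmbedding_orbitSeq d
    change ∀ᵐ y ∂(orbitMeasure d), g y = 0
    rw [orbitMeasure, hme.ae_map_iff]
    exact hzero
  · rintro α rfl
    refine ⟨by simp, fun _ => 1, memLp_const 1, fun h => ?_, by simp⟩
    obtain ⟨x, hx⟩ := h.exists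
    simp at hx

lemma weightedMoment_mul {ι : Type} [Fintype ι] (ε h : ι → ℤ) (r : ℤ) (i : ℕ) :
    weightedMoment ε (fun j => r * h j) i = r ^ i * weightedMoment ε h i := by
  simp only [weightedMoment, Finset.mul_sum]
  exact Finset.sum_congr rfl fun j _ => by ring

lemma stronglyStationary_orbitMeasure (d : ℕ) : StronglyStationary (orbitMeasure d) := by
  intro l r _ hr n F hF
  have hflag : ∀ j, ∃ b : Bool, F j = fun x => conjIf b (coordZero x) := by
    intro j
    rcases hF j with h | h
    · exact ⟨false, by rw [h]; rfl⟩
    · exact ⟨true, by rw [h]; rfl⟩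
  choose σ hσ using hflag
  simp only [hσ, coordZero, shift_zpow_apply, add_zero]
  rw [integral_correlation_orbitMeasure, integral_correlation_orbitMeasure]
  have hr0 : (r : ℤ) ≠ 0 := by exact_mod_cast (Nat.one_le_iff_ne_zero.1 hr)
  simp only [weightedMoment_mul, mul_eq_zero, pow_ne_zero _ hr0, false_or]

lemma systemIsomorphic_orbitMeasure (d : ℕ) :
    SystemIsomorphic (orbitMeasure d) shift
      (volume : Measure (Fin (d + 1) → UnitAddCircle)) (unipotentMap d) := by
  have hme := measurableEmbedding_orbitSeq d
  have hleft := hme.leftInverse_invFun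
  have hfull : orbitMeasure d (Set.range (orbitSeq d))ᶜ = 0 := by
    rw [orbitMeasure, hme.map_apply]
    simp
  refine ⟨hme.invFun, ⟨hme.measurable_invFun, ?_⟩, ?_, Set.range (orbitSeq d),
    hme.measurableSet_range, ?_, hfull, ?_⟩
  · rw [orbitMeasure, Measure.map_map hme.measurable_invFun hme.measurable, hleft.comp_eq_id,
      Measure.map_id]
  · have hrange : ∀ᵐ y ∂(orbitMeasure d), y ∈ Set.range (orbitSeq d) := hfull
    filter_upwards [hrange] with y hy
    obtain ⟨x, rfl⟩ := hy
    rw [shift_orbitSeq, hleft, hleft]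
  · ext y
    constructor
    · rintro ⟨x, hx⟩
      obtain ⟨x', rfl⟩ := surjective_unipotentMap d x
      exact ⟨x', shift.injective (by rw [shift_orbitSeq, hx])⟩
    · rintro ⟨x, rfl⟩
      exact ⟨unipotentMap d x, (shift_orbitSeq d x).symm⟩
  · rintro _ ⟨x, rfl⟩ _ ⟨y, rfl⟩ hxy
    rw [hleft, hleft] at hxy
    rw [hxy]

end

theorem theorem2p17
    (f : ℕ+ →* Circle) (t s : ℕ → ℤ) (hf : IsMRTWith f t s)
    (d : ℕ) (N : ℕ → ℕ) (hNpos : ∀ m : ℕ, 1 ≤ m → 0 < N m)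
    (hN_zero : d = 0 →
      Prec (fun m => (s (m + 1) : ℝ)) (fun m => (N m : ℝ)) ∧
        ∀ m : ℕ, 1 ≤ m → (N m : ℤ) ≤ t (m + 1))
    (hN_pos : 0 < d →
      Prec (fun m => (s (m + 1) : ℝ) ^ (1 / ((d : ℝ) + 1))) (fun m => (N m : ℝ)) ∧
        Prec (fun m => (N m : ℝ)) (fun m => (s (m + 1) : ℝ) ^ (1 / (d : ℝ))))
    (a : SeqSpace) (ha : ∀ n : ℕ+, (a ((n : ℕ) : ℤ) : ℂ) = (f n : ℂ)) :
    (∃ μ : Measure SeqSpace, IsFurstenbergMeasure a N μ) ∧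
      ∀ μ : Measure SeqSpace, IsFurstenbergMeasure a N μ →
        MeasurePreserving shift μ μ ∧
        systemSpectrum μ shift = {0} ∧
        StronglyStationary μ ∧
        SystemIsomorphic μ shift
          (volume : Measure (Fin (d + 1) → UnitAddCircle)) (unipotentMap d) := by
  have hlim := hf.isFurstenbergMeasure_orbitMeasure
    (hf.admissibleGrowth hNpos hN_zero hN_pos) ha
  refine ⟨⟨_, hlim⟩, fun μ hμ => ?_⟩
  obtain rfl := hμ.unique hlim
  exact ⟨measurePreserving_shift_orbitMeasure d, systemSpectrum_orbitMeasure d,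
    stronglyStationary_orbitMeasure d, systemIsomorphic_orbitMeasure d⟩
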